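/- **Setting.** Let $n,m\ge 0$, $\gamma\in(0,1)$, and consider $x^+=f(x,u,\xi)=Ax+Bu+c+\xi$ on $\mathbb R^n\times\mathbb R^m$, where $\xi$ is a random vector in $\mathbb R^n$ with finite second moments, mean $\mu$ and covariance $\Sigma$, and $(\sqrt\gamma A,\sqrt\gamma B)$ is stabilizable. Let the stage cost $$\ell(x,u)=\begin{bmatrix}x\\u\end{bmatrix}^{\!\top}\!\begin{bmatrix}L_{xx}&L_{xu}\\L_{xu}^\top&L_{uu}\end{bmatrix}\begin{bmatrix}x\\u\end{bmatrix}+2\begin{bmatrix}x\\u\end{bmatrix}^{\!\top}\!\begin{bmatrix}L_x\\L_u\end{bmatrix}+L_c$$ be nonnegative on $\mathbb R^n\times\mathbb R^m$, with $L_{xx}$ symmetric and $L_{uu}\succ0$. For $q:\mathbb R^n\times\mathbb R^m\to\mathbb R$ put $$(\mathcal Fq)(x,u)=\ell(x,u)+\gamma\,\mathbb E\big[\inf_w q(f(x,u,\xi),w)\big],\qquad(\hat{\mathcal F}q)(x,u)=\ell(x,u)+\gamma\inf_w\mathbb E\big[q(f(x,u,\xi),w)\big];$$ a fixed point of either operator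 is a real function $q$ for which all these infima and expectations are finite and which equals its image. Let $\mathcal S$ be the space of measurable $q$ with $|q(x,u)|\le C(1+|x|^2+|u|^2)$ for some $C$. With $\tilde A=\begin{bmatrix}A&c+\mu\\0&1\end{bmatrix}$, $\tilde B=\begin{bmatrix}B\\0\end{bmatrix}$, $\tilde L_{xx}=\begin{bmatrix}L_{xx}&L_x\\L_x^\top&L_c\end{bmatrix}$, $\tilde L_{xu}=\begin{bmatrix}L_{xu}\\L_u^\top\end{bmatrix}$ and $\tilde P=\begin{bmatrix}P&P_\ell\\P_\ell^\top&P_c\end{bmatrix}$, write $$\tilde q=\tilde L_{xx}+\gamma\tilde A^\top\tilde P\tilde A=\begin{bmatrix}q&q_x\\q_x^\top&Q_c\end{bmatrix},\quad \tilde q_\ell=\tilde L_{xu}+\gamma\tilde A^\top\tilde P\tilde B=\begin{bmatrix}q_\ell\\q_u^\top\end{bmatrix},\quad q_c=L_{uu}+\gamma\tilde B^\top\tilde P\tilde B .$$ A *Riccati solution* is a symmetric $\tilde P\succeq0$ with $\tilde P=\tilde q-\tilde q_\ell q_c^{-1}\tilde q_\ell^\top$. To it belong $$q^*(x,u)=\begin{bmatrix}x\\u\end{bmatrix}^{\!\top}\!\begin{bmatrix}q&q_\ell\\q_\ell^\top&q_c\end{bmatrix}\begin{bmatrix}x\\u\end{bmatrix}+2\begin{bmatrix}x\\u\end{bmatrix}^{\!\top}\!\begin{bmatrix}q_x\\q_u\end{bmatrix}+Q_c+\frac{\gamma\operatorname{Tr}(P\Sigma)}{1-\gamma},$$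 $$\hat q(x,u)=q^*(x,u)+\frac{\gamma\operatorname{Tr}(q_\ell q_c^{-1}q_\ell^\top\Sigma)}{1-\gamma},\qquad \pi^*(x)=-q_c^{-1}\big(q_\ell^\top x+L_u+\gamma B^\top(P_\ell+P(c+\mu))\big).$$ **Proposition 3.** 1. For every Riccati solution $\tilde P$: $q_c\succ0$; $q^*,\hat q\in\mathcal S$; $q^*$ is a fixed point of $\mathcal F$ and $\hat q$ is a fixed point of $\hat{\mathcal F}$; the constant $\hat q-q^*$ is nonnegative, so $0\le q^*\le\hat q$; and for every $x$, $\pi^*(x)$ is the unique minimizer both of $\hat q(x,\cdot)$ and of $q^*(x,\cdot)$. 2. There is a least Riccati solution $\tilde P^*$ (in the Loewner order). For $\tilde P=\tilde P^*$: $q^*$ is the least nonnegative measurable fixed point of $\mathcal F$; $\hat q$ is the least nonnegative measurable fixed point of $\hat{\mathcal F}$; and $\pi^*$ is an optimal policy, i.e. it minimizes, for every initial state $x$ and among all measurable stationary policies $\pi:\mathbb R^n\to\mathbb R^m$, the cost $v_\pi(x)=\mathbb E\big[\sum_{k\ge0}\gamma^k\ell(x_k,\pi(x_k))\big]$, where $x_0=x$,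 $x_{k+1}=f(x_k,\pi(x_k),\xi_k)$ and the $\xi_k$ are i.i.d. copies of $\xi$. 3. For $\tilde P=\tilde P^*$: $\hat q$ is the only nonnegative fixed point of $\hat{\mathcal F}$ in $\mathcal S$ if and only if $\tilde P^*$ is the only Riccati solution; likewise $q^*$ is the only nonnegative fixed point of $\mathcal F$ in $\mathcal S$ if and only if $\tilde P^*$ is the only Riccati solution. -/

import Mathlib

open MeasureTheory Matrix

noncomputable section

/-- Data of a discounted stochastic control problem on `ℝⁿ × ℝᵐ` with affine dynamics
`x⁺ = A x + B u + c + ξ`, where `ξ` has law `noise`, discount factor `γ`, and generalized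
quadratic stage cost. -/
structure AffineLQ (n m : ℕ) where
  A : Matrix (Fin n) (Fin n) ℝ
  B : Matrix (Fin n) (Fin m) ℝ
  c : Fin n → ℝ
  γ : ℝ
  Lxx : Matrix (Fin n) (Fin n) ℝ
  Lxu : Matrix (Fin n) (Fin m) ℝ
  Luu : Matrix (Fin m) (Fin m) ℝ
  Lx : Fin n → ℝ
  Lu : Fin m → ℝ
  Lc : ℝ
  noise : Measure (Fin n → ℝ)

namespace AffineLQ

variable {n m : ℕ} (S : AffineLQ n m)

/-! ### The control problem -/

/-- `f(x, u, ξ) = A x + B u + c + ξ`. -/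
def dyn (x : Fin n → ℝ) (u : Fin m → ℝ) (ξ : Fin n → ℝ) : Fin n → ℝ :=
  S.A *ᵥ x + S.B *ᵥ u + S.c + ξ

/-- The stage cost `zᵀ L z + 2 zᵀ L_ℓ + L_c` with `z = (x, u)`. -/
def cost (x : Fin n → ℝ) (u : Fin m → ℝ) : ℝ :=
  Sum.elim x u ⬝ᵥ (fromBlocks S.Lxx S.Lxu S.Lxuᵀ S.Luu *ᵥ Sum.elim x u)
    + 2 * (Sum.elim x u ⬝ᵥ Sum.elim S.Lx S.Lu) + S.Lc

/-- Mean of the noise. -/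
def mean : Fin n → ℝ := fun i => ∫ ξ, ξ i ∂S.noise

/-- Covariance matrix of the noise. -/
def cov : Matrix (Fin n) (Fin n) ℝ :=
  Matrix.of fun i j => ∫ ξ, (ξ i - S.mean i) * (ξ j - S.mean j) ∂S.noise

/-- `(√γ A, √γ B)` is stabilizable: some feedback gain `K` places all (complex) eigenvalues of
`√γ A + √γ B K` in the open unit disc. -/
def Stabilizable : Prop :=
  ∃ K : Matrix (Fin m) (Fin n) ℝ,
    ∀ z ∈ spectrum ℂ ((√S.γ • S.A + (√S.γ • S.B) * K).map (algebraMap ℝ ℂ)), ‖z‖ < 1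

/-- State at time `k` under the policy `π`, from the initial state `x`, along the noise
sequence `ω`. -/
def traj (π : (Fin n → ℝ) → (Fin m → ℝ)) (x : Fin n → ℝ) (ω : ℕ → Fin n → ℝ) :
    ℕ → Fin n → ℝ
  | 0 => x
  | k + 1 => S.dyn (traj π x ω k) (π (traj π x ω k)) (ω k)

/-- The expected discounted cost `v_π(x)` of a stationary policy; the noise sequence is
i.i.d. with law `noise`. The stage costs are nonnegative, so the value lies in `[0, ∞]`. -/
def policyCost [IsProbabilityMeasure S.noise] (π : (Fin n → ℝ) → (Fin m → ℝ))
    (x : Fin n → ℝ) : ENNReal :=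
  ∫⁻ ω, ∑' k : ℕ, ENNReal.ofReal (S.γ ^ k * S.cost (S.traj π x ω k) (π (S.traj π x ω k)))
    ∂(Measure.infinitePi fun _ : ℕ => S.noise)

/-- `π` is measurable and attains `inf_π' v_π'(x)` for every `x`. -/
def IsOptimalPolicy [IsProbabilityMeasure S.noise] (π : (Fin n → ℝ) → (Fin m → ℝ)) : Prop :=
  Measurable π ∧
    ∀ π' : (Fin n → ℝ) → (Fin m → ℝ), Measurable π' → ∀ x, S.policyCost π x ≤ S.policyCost π' x

/-! ### Bellman operators on Q-functions -/

/-- `(F q)(x, u) = ℓ(x, u) + γ E[inf_w q(f(x, u, ξ), w)]`. -/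
def bellman (q : (Fin n → ℝ) → (Fin m → ℝ) → ℝ) (x : Fin n → ℝ) (u : Fin m → ℝ) : ℝ :=
  S.cost x u + S.γ * ∫ ξ, ⨅ w, q (S.dyn x u ξ) w ∂S.noise

/-- `(F̂ q)(x, u) = ℓ(x, u) + γ inf_w E[q(f(x, u, ξ), w)]`. -/
def relaxedBellman (q : (Fin n → ℝ) → (Fin m → ℝ) → ℝ) (x : Fin n → ℝ) (u : Fin m → ℝ) : ℝ :=
  S.cost x u + S.γ * ⨅ w, ∫ ξ, q (S.dyn x u ξ) w ∂S.noise

/-- `q` is a fixed point of `F`; the infima and the expectations in `F q` are required to be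
finite, so that no default value of `⨅` or `∫` is involved. -/
def IsBellmanFixedPoint (q : (Fin n → ℝ) → (Fin m → ℝ) → ℝ) : Prop :=
  (∀ x, BddBelow (Set.range (q x))) ∧
  (∀ x u, Integrable (fun ξ => ⨅ w, q (S.dyn x u ξ) w) S.noise) ∧
  ∀ x u, S.bellman q x u = q x u

/-- `q` is a fixed point of `F̂`; the expectations and the infima in `F̂ q` are required to be
finite. -/
def IsRelaxedFixedPoint (q : (Fin n → ℝ) → (Fin m → ℝ) → ℝ) : Prop :=
  (∀ x u w, Integrable (fun ξ => q (S.dyn x u ξ) w) S.noise) ∧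
  (∀ x u, BddBelow (Set.range fun w => ∫ ξ, q (S.dyn x u ξ) w ∂S.noise)) ∧
  ∀ x u, S.relaxedBellman q x u = q x u

/-! ### The augmented Riccati equation and the closed forms -/

/-- `Ã = [A, c + μ; 0, 1]`. -/
def augA : Matrix (Fin n ⊕ Unit) (Fin n ⊕ Unit) ℝ :=
  fromBlocks S.A (replicateCol Unit (S.c + S.mean)) 0 1

/-- `B̃ = [B; 0]`. -/
def augB : Matrix (Fin n ⊕ Unit) (Fin m) ℝ := fromRows S.B 0

/-- `L̃_xx = [L_xx, L_x; L_xᵀ, L_c]`. -/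
def augLxx : Matrix (Fin n ⊕ Unit) (Fin n ⊕ Unit) ℝ :=
  fromBlocks S.Lxx (replicateCol Unit S.Lx) (replicateRow Unit S.Lx) (Matrix.of fun _ _ => S.Lc)

/-- `L̃_xu = [L_xu; L_uᵀ]`. -/
def augLxu : Matrix (Fin n ⊕ Unit) (Fin m) ℝ := fromRows S.Lxu (replicateRow Unit S.Lu)

variable (P : Matrix (Fin n ⊕ Unit) (Fin n ⊕ Unit) ℝ)

/-- `q̃ = L̃_xx + γ Ãᵀ P̃ Ã`. -/
def augQ : Matrix (Fin n ⊕ Unit) (Fin n ⊕ Unit) ℝ := S.augLxx + S.γ • (S.augAᵀ * P * S.augA)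

/-- `q̃_ℓ = L̃_xu + γ Ãᵀ P̃ B̃`. -/
def augQl : Matrix (Fin n ⊕ Unit) (Fin m) ℝ := S.augLxu + S.γ • (S.augAᵀ * P * S.augB)

/-- `q_c = q̃_c = L_uu + γ B̃ᵀ P̃ B̃`. -/
def qc : Matrix (Fin m) (Fin m) ℝ := S.Luu + S.γ • (S.augBᵀ * P * S.augB)

/-- `P̃` is a symmetric positive semidefinite solution of the augmented algebraic Riccati
equation `P̃ = q̃ - q̃_ℓ q̃_c⁻¹ q̃_ℓᵀ`. -/
def IsRiccatiSolution : Prop :=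
  P.PosSemidef ∧ P = S.augQ P - S.augQl P * (S.qc P)⁻¹ * (S.augQl P)ᵀ

/-- The block `q_ℓ` of `q̃_ℓ = [q_ℓ; q_uᵀ]`. -/
def ql : Matrix (Fin n) (Fin m) ℝ := (S.augQl P).toRows₁

/-- The quadratic part `Q = [q, q_ℓ; q_ℓᵀ, q_c]` of the Q-function. -/
def Qquad : Matrix (Fin n ⊕ Fin m) (Fin n ⊕ Fin m) ℝ :=
  fromBlocks (S.augQ P).toBlocks₁₁ (S.ql P) (S.ql P)ᵀ (S.qc P)

/-- The linear part `Q_ℓ = [q_x; q_u]` of the Q-function. -/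
def Qlin : Fin n ⊕ Fin m → ℝ :=
  Sum.elim (fun i => S.augQ P (Sum.inl i) (Sum.inr ())) (fun j => S.augQl P (Sum.inr ()) j)

/-- `q*(x, u) = zᵀ Q z + 2 zᵀ Q_ℓ + Q_c + γ Tr(P Σ) / (1 - γ)` with `z = (x, u)`. -/
def qStar (x : Fin n → ℝ) (u : Fin m → ℝ) : ℝ :=
  Sum.elim x u ⬝ᵥ (S.Qquad P *ᵥ Sum.elim x u) + 2 * (Sum.elim x u ⬝ᵥ S.Qlin P)
    + S.augQ P (Sum.inr ()) (Sum.inr ()) + S.γ * (P.toBlocks₁₁ * S.cov).trace / (1 - S.γ)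

/-- The constant `γ Tr(q_ℓ q_c⁻¹ q_ℓᵀ Σ) / (1 - γ)`. -/
def gap : ℝ :=
  S.γ * (S.ql P * (S.qc P)⁻¹ * (S.ql P)ᵀ * S.cov).trace / (1 - S.γ)

/-- `q̂(x, u) = q*(x, u) + γ Tr(q_ℓ q_c⁻¹ q_ℓᵀ Σ) / (1 - γ)`. -/
def qHat (x : Fin n → ℝ) (u : Fin m → ℝ) : ℝ := S.qStar P x u + S.gap P

/-- The affine policy `π(x) = -q_c⁻¹ (q_ℓᵀ x + L_u + γ Bᵀ (P_ℓ + P (c + μ)))`. -/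
def policy (x : Fin n → ℝ) : Fin m → ℝ :=
  -((S.qc P)⁻¹ *ᵥ ((S.ql P)ᵀ *ᵥ x + (S.Lu + S.γ •
    (S.Bᵀ *ᵥ ((fun i => P (Sum.inl i) (Sum.inr ())) + P.toBlocks₁₁ *ᵥ (S.c + S.mean))))))

end AffineLQ

/-- Measurable functions on `ℝⁿ × ℝᵐ` with finite weighted sup-norm, for the weight
`1 + |x|² + |u|²`. -/
def QuadGrowth {n m : ℕ} (q : (Fin n → ℝ) → (Fin m → ℝ) → ℝ) : Prop :=
  Measurable (Function.uncurry q) ∧ ∃ C : ℝ, ∀ x u, |q x u| ≤ C * (1 + x ⬝ᵥ x + u ⬝ᵥ u)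

end

open Filter Topology

noncomputable section

/-! ### Quadratic forms of real matrices -/

/-! Appending a coordinate with constant value 1 to the state makes the affine problem purely
quadratic, and the noise then contributes only a constant: the mean of a quadratic polynomial with
quadratic part `M` is its value at the mean successor plus `tr (M Σ)`. Hence both operators preserve
functions of the form `qForm P + a`. They send `P` to `riccati P` and `a` to `γ (a + τ)`, where `τ`
is the trace of `Σ` against the upper left block of `riccati P` for `F`, which minimizes before
averaging, and of `augQ P` for `F̂`, which averages first. At a Riccati solution these blocks differ
by `q_ℓ q_c⁻¹ q_ℓᵀ`, which accounts for `gap`. Completing the square (`qForm_eq_riccati`) yields the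
minimal value and the unique minimizer together.

Everything else is monotone iteration. `riccati` is monotone, and stabilizability provides
supersolutions above any multiple of the identity (`exists_riccati_le`). Iteration from `0`
therefore increases to the least Riccati solution. A nonnegative fixed point dominates the stage
cost, which is `qForm 0`, hence every iterate and the limit. The same induction on finite horizons
bounds the cost of every policy from below, while the affine policy attains the bound.

For uniqueness, a fixed point of quadratic growth lies below some `qForm U + a` with `U` a
supersolution. Iteration from `U` decreases to a Riccati solution; if there is only one, the fixed
point is squeezed. Conversely, distinct Riccati solutions give distinct fixed points: minimizing
over `u` recovers the value function, and the additive constant depends only on the upper left block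
of `P`. -/

theorem Matrix.PosSemidef.isSymm {ι : Type*} {P : Matrix ι ι ℝ} (hP : P.PosSemidef) : P.IsSymm := by
  simpa [IsHermitian, IsSymm, conjTranspose_eq_transpose_of_trivial] using hP.isHermitian

section QuadVal

variable {ι κ : Type*} [Fintype ι] [Fintype κ]

/-- The value `zᵀ P z`. -/
def quadVal (P : Matrix ι ι ℝ) (z : ι → ℝ) : ℝ := z ⬝ᵥ (P *ᵥ z)

theorem Matrix.IsSymm.dotProduct_mulVec_comm {P : Matrix ι ι ℝ} (hP : P.IsSymm) (z w : ι → ℝ) :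
    z ⬝ᵥ (P *ᵥ w) = w ⬝ᵥ (P *ᵥ z) := by
  rw [dotProduct_mulVec, ← mulVec_transpose, hP.eq, dotProduct_comm]

theorem dotProduct_mulVec_transpose (Y : Matrix ι κ ℝ) (z : ι → ℝ) (u : κ → ℝ) :
    u ⬝ᵥ (Yᵀ *ᵥ z) = z ⬝ᵥ (Y *ᵥ u) := by
  rw [mulVec_transpose, dotProduct_comm, ← dotProduct_mulVec]

theorem quadVal_vecAdd {P : Matrix ι ι ℝ} (hP : P.IsSymm) (z w : ι → ℝ) :
    quadVal P (z + w) = quadVal P z + 2 * (z ⬝ᵥ (P *ᵥ w)) + quadVal P w := by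
  simp only [quadVal, mulVec_add, dotProduct_add, add_dotProduct]
  rw [hP.dotProduct_mulVec_comm w z]; ring

theorem quadVal_add (P P' : Matrix ι ι ℝ) (z : ι → ℝ) :
    quadVal (P + P') z = quadVal P z + quadVal P' z := by
  simp [quadVal, add_mulVec, dotProduct_add]

theorem quadVal_sub (P P' : Matrix ι ι ℝ) (z : ι → ℝ) :
    quadVal (P - P') z = quadVal P z - quadVal P' z := by
  simp [quadVal, sub_mulVec, dotProduct_sub]

theorem quadVal_smul (a : ℝ) (P : Matrix ι ι ℝ) (z : ι → ℝ) :
    quadVal (a • P) z = a * quadVal P z := by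
  simp [quadVal, smul_mulVec]

theorem quadVal_vecSmul (P : Matrix ι ι ℝ) (a : ℝ) (z : ι → ℝ) :
    quadVal P (a • z) = a ^ 2 * quadVal P z := by
  simp only [quadVal, mulVec_smul, dotProduct_smul, smul_dotProduct, smul_eq_mul]; ring

theorem quadVal_sum {σ : Type*} (s : Finset σ) (P : σ → Matrix ι ι ℝ) (z : ι → ℝ) :
    quadVal (∑ i ∈ s, P i) z = ∑ i ∈ s, quadVal (P i) z := by
  classical
  induction s using Finset.induction_on with
  | empty => simp [quadVal]
  | insert a s ha ih => rw [Finset.sum_insert ha, Finset.sum_insert ha, quadVal_add, ih]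

theorem quadVal_transpose_mul_mul (P : Matrix ι ι ℝ) (M : Matrix ι κ ℝ) (z : κ → ℝ) :
    quadVal (Mᵀ * P * M) z = quadVal P (M *ᵥ z) := by
  simp only [quadVal]
  rw [← mulVec_mulVec, ← mulVec_mulVec, dotProduct_mulVec_transpose, dotProduct_comm]

theorem quadVal_one [DecidableEq ι] (z : ι → ℝ) : quadVal (1 : Matrix ι ι ℝ) z = z ⬝ᵥ z := by
  simp [quadVal]

theorem Matrix.PosSemidef.quadVal_nonneg {P : Matrix ι ι ℝ} (hP : P.PosSemidef) (z : ι → ℝ) :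
    0 ≤ quadVal P z := by
  simpa [quadVal] using hP.dotProduct_mulVec_nonneg z

theorem posSemidef_of_quadVal_nonneg {P : Matrix ι ι ℝ} (hP : P.IsSymm)
    (h : ∀ z, 0 ≤ quadVal P z) : P.PosSemidef := by
  refine PosSemidef.of_dotProduct_mulVec_nonneg ?_ fun z => by simpa [quadVal] using h z
  simpa [IsHermitian, IsSymm, conjTranspose_eq_transpose_of_trivial] using hP

theorem quadVal_pos {P : Matrix ι ι ℝ} (hP : P.PosDef) {z : ι → ℝ} (hz : z ≠ 0) :
    0 < quadVal P z := by
  simpa [quadVal] using hP.dotProduct_mulVec_pos hz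

theorem entry_eq_polarization [DecidableEq ι] {P : Matrix ι ι ℝ} (hP : P.IsSymm) (i j : ι) :
    P i j = (quadVal P (Pi.single i 1 + Pi.single j 1) - quadVal P (Pi.single i 1)
      - quadVal P (Pi.single j 1)) / 2 := by
  rw [quadVal_vecAdd hP]
  have : Pi.single i 1 ⬝ᵥ (P *ᵥ Pi.single j 1) = P i j := by simp
  rw [this]; ring

theorem eq_of_quadVal_eq {P P' : Matrix ι ι ℝ} (hP : P.IsSymm) (hP' : P'.IsSymm)
    (h : ∀ z, quadVal P z = quadVal P' z) : P = P' := by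
  classical
  ext i j
  rw [entry_eq_polarization hP, entry_eq_polarization hP', h, h, h]

/-- Completion of the square with respect to the second block of variables. -/
theorem quadVal_complete_square [DecidableEq κ] (X : Matrix ι ι ℝ) (Y : Matrix ι κ ℝ)
    {Z : Matrix κ κ ℝ} (hZ : Z.PosDef) (z : ι → ℝ) (u : κ → ℝ) :
    quadVal X z + 2 * (z ⬝ᵥ (Y *ᵥ u)) + quadVal Z u
      = quadVal (X - Y * Z⁻¹ * Yᵀ) z + quadVal Z (u + Z⁻¹ *ᵥ (Yᵀ *ᵥ z)) := by
  have hu : IsUnit Z.det := (isUnit_iff_isUnit_det _).1 hZ.isUnit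
  have h1 : Z *ᵥ (Z⁻¹ *ᵥ (Yᵀ *ᵥ z)) = Yᵀ *ᵥ z := by
    rw [mulVec_mulVec, mul_nonsing_inv _ hu, one_mulVec]
  rw [quadVal_vecAdd hZ.posSemidef.isSymm, h1, dotProduct_mulVec_transpose, quadVal_sub]
  have h2 : quadVal Z (Z⁻¹ *ᵥ (Yᵀ *ᵥ z)) = quadVal (Y * Z⁻¹ * Yᵀ) z := by
    unfold quadVal
    rw [h1, ← mulVec_mulVec, ← mulVec_mulVec, dotProduct_mulVec_transpose]
  rw [h2]; ring

/-- A symmetric matrix sequence whose quadratic forms converge pointwise converges. -/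
theorem exists_tendsto_of_quadVal {P : ℕ → Matrix ι ι ℝ} (hP : ∀ k, (P k).IsSymm)
    (h : ∀ z, ∃ a, Tendsto (fun k => quadVal (P k) z) atTop (𝓝 a)) :
    ∃ Q : Matrix ι ι ℝ, Tendsto P atTop (𝓝 Q) := by
  classical
  choose a ha using h
  refine ⟨Matrix.of fun i j => (a (Pi.single i 1 + Pi.single j 1) - a (Pi.single i 1)
      - a (Pi.single j 1)) / 2, ?_⟩
  refine tendsto_pi_nhds.2 fun i => tendsto_pi_nhds.2 fun j => ?_
  simp_rw [fun k => entry_eq_polarization (hP k) i j]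
  exact (((ha _).sub (ha _)).sub (ha _)).div_const 2

theorem continuous_quadVal (z : ι → ℝ) : Continuous fun P : Matrix ι ι ℝ => quadVal P z := by
  unfold quadVal
  fun_prop

/-- Bounded monotone quadratic forms converge pointwise, and polarization turns this into entrywise
convergence. -/
theorem exists_tendsto_of_monotone {P : ℕ → Matrix ι ι ℝ} (hP : ∀ k, (P k).IsSymm)
    (hmono : ∀ k z, quadVal (P k) z ≤ quadVal (P (k + 1)) z) {U : Matrix ι ι ℝ}
    (hU : ∀ k z, quadVal (P k) z ≤ quadVal U z) :
    ∃ Q : Matrix ι ι ℝ, Tendsto P atTop (𝓝 Q) :=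
  exists_tendsto_of_quadVal hP fun z =>
    ⟨_, tendsto_atTop_ciSup (monotone_nat_of_le_succ fun k => hmono k z)
      ⟨quadVal U z, by rintro _ ⟨k, rfl⟩; exact hU k z⟩⟩

theorem exists_tendsto_of_antitone {P : ℕ → Matrix ι ι ℝ} (hP : ∀ k, (P k).IsSymm)
    (hanti : ∀ k z, quadVal (P (k + 1)) z ≤ quadVal (P k) z)
    (h0 : ∀ k z, 0 ≤ quadVal (P k) z) :
    ∃ Q : Matrix ι ι ℝ, Tendsto P atTop (𝓝 Q) :=
  exists_tendsto_of_quadVal hP fun z =>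
    ⟨_, tendsto_atTop_ciInf (antitone_nat_of_succ_le fun k => hanti k z)
      ⟨0, by rintro _ ⟨k, rfl⟩; exact h0 k z⟩⟩

theorem posSemidef_of_tendsto {P : ℕ → Matrix ι ι ℝ} {Q : Matrix ι ι ℝ}
    (hP : ∀ k, (P k).PosSemidef) (h : Tendsto P atTop (𝓝 Q)) : Q.PosSemidef := by
  refine posSemidef_of_quadVal_nonneg ?_ fun z => ?_
  · have h1 : Tendsto (fun k => (P k)ᵀ) atTop (𝓝 Qᵀ) :=
      ((continuous_id.matrix_transpose).tendsto Q).comp h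
    simp_rw [fun k => (hP k).isSymm.eq] at h1
    exact tendsto_nhds_unique h1 h
  · exact ge_of_tendsto' (((continuous_quadVal z).tendsto Q).comp h) fun k => (hP k).quadVal_nonneg z

theorem tendsto_matrix_inv [DecidableEq ι] {P : ℕ → Matrix ι ι ℝ} {Q : Matrix ι ι ℝ}
    (hQ : IsUnit Q) (h : Tendsto P atTop (𝓝 Q)) :
    Tendsto (fun k => (P k)⁻¹) atTop (𝓝 Q⁻¹) := by
  simp_rw [Matrix.inv_def, Ring.inverse_eq_inv']
  have hd : Q.det ≠ 0 := ((isUnit_iff_isUnit_det _).1 hQ).ne_zero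
  exact (((continuous_id.matrix_det.tendsto Q).comp h).inv₀ hd).smul
    ((continuous_id.matrix_adjugate.tendsto Q).comp h)

end QuadVal

namespace AffineLQ

variable {n m : ℕ}

/-! ### The homogenized problem -/

/-- The vector `(x, 1)`. -/
def aug (x : Fin n → ℝ) : Fin n ⊕ Unit → ℝ := Sum.elim x fun _ => 1

theorem quadVal_sumElim {W : Matrix (Fin n ⊕ Unit) (Fin n ⊕ Unit) ℝ} (hW : W.IsSymm)
    (x : Fin n → ℝ) (s : ℝ) :
    quadVal W (Sum.elim x fun _ => s) = quadVal W.toBlocks₁₁ x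
      + 2 * s * (x ⬝ᵥ fun i => W (Sum.inl i) (Sum.inr ())) + s ^ 2 * W (Sum.inr ()) (Sum.inr ()) := by
  have h : ∀ i, W (Sum.inr ()) (Sum.inl i) = W (Sum.inl i) (Sum.inr ()) := fun i => hW.apply _ _
  simp only [quadVal, dotProduct, mulVec, Fintype.sum_sum_type, Sum.elim_inl, Sum.elim_inr,
    Finset.univ_unique, Finset.sum_singleton, toBlocks₁₁, of_apply, h, mul_add,
    Finset.sum_add_distrib]
  have h1 : ∑ i, x i * (W (Sum.inl i) (Sum.inr ()) * s)
      = s * ∑ i, x i * W (Sum.inl i) (Sum.inr ()) := by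
    rw [Finset.mul_sum]; exact Finset.sum_congr rfl fun i _ => by ring
  have h2 : s * ∑ i, W (Sum.inl i) (Sum.inr ()) * x i
      = s * ∑ i, x i * W (Sum.inl i) (Sum.inr ()) := by
    congr 1; exact Finset.sum_congr rfl fun i _ => by ring
  change _ + s * ∑ i, W (Sum.inl i) (Sum.inr ()) * x i
    + (∑ i, x i * (W (Sum.inl i) (Sum.inr ()) * s) + s * (W (Sum.inr ()) (Sum.inr ()) * s)) = _
  rw [h1, h2]; ring

theorem quadVal_aug {W : Matrix (Fin n ⊕ Unit) (Fin n ⊕ Unit) ℝ} (hW : W.IsSymm)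
    (x : Fin n → ℝ) :
    quadVal W (aug x) = quadVal W.toBlocks₁₁ x
      + 2 * (x ⬝ᵥ fun i => W (Sum.inl i) (Sum.inr ())) + W (Sum.inr ()) (Sum.inr ()) := by
  simpa [aug] using quadVal_sumElim hW x 1

theorem aug_dotProduct_mulVec (Y : Matrix (Fin n ⊕ Unit) (Fin m) ℝ) (x : Fin n → ℝ)
    (u : Fin m → ℝ) :
    aug x ⬝ᵥ (Y *ᵥ u) = x ⬝ᵥ (Y.toRows₁ *ᵥ u) + u ⬝ᵥ Y (Sum.inr ()) := by
  simp only [aug, dotProduct, mulVec, Fintype.sum_sum_type, Sum.elim_inl, Sum.elim_inr,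
    Finset.univ_unique, Finset.sum_singleton, toRows₁, of_apply, one_mul]
  congr 1
  exact Finset.sum_congr rfl fun i _ => mul_comm _ _

theorem quadVal_fromBlocks (X : Matrix (Fin n) (Fin n) ℝ) (Y : Matrix (Fin n) (Fin m) ℝ)
    (Z : Matrix (Fin m) (Fin m) ℝ) (x : Fin n → ℝ) (u : Fin m → ℝ) :
    Sum.elim x u ⬝ᵥ (fromBlocks X Y Yᵀ Z *ᵥ Sum.elim x u)
      = quadVal X x + 2 * (x ⬝ᵥ (Y *ᵥ u)) + quadVal Z u := by
  rw [fromBlocks_mulVec, sumElim_dotProduct_sumElim]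
  simp only [Sum.elim_comp_inl, Sum.elim_comp_inr, dotProduct_add, dotProduct_mulVec_transpose,
    quadVal]
  ring

variable (S : AffineLQ n m)

/-- The homogenized stage cost. -/
def augCost (z : Fin n ⊕ Unit → ℝ) (u : Fin m → ℝ) : ℝ :=
  quadVal S.augLxx z + 2 * (z ⬝ᵥ (S.augLxu *ᵥ u)) + quadVal S.Luu u

/-- The one-step cost with terminal cost `zᵀ P z` of the homogenized noise-free problem. -/
def qForm (P : Matrix (Fin n ⊕ Unit) (Fin n ⊕ Unit) ℝ) (z : Fin n ⊕ Unit → ℝ)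
    (u : Fin m → ℝ) : ℝ :=
  S.augCost z u + S.γ * quadVal P (S.augA *ᵥ z + S.augB *ᵥ u)

/-- The Riccati operator `P ↦ q̃ - q̃_ℓ q_c⁻¹ q̃_ℓᵀ`. -/
def riccati (P : Matrix (Fin n ⊕ Unit) (Fin n ⊕ Unit) ℝ) :
    Matrix (Fin n ⊕ Unit) (Fin n ⊕ Unit) ℝ :=
  S.augQ P - S.augQl P * (S.qc P)⁻¹ * (S.augQl P)ᵀ

/-- The homogenized minimizing feedback. -/
def augPolicy (P : Matrix (Fin n ⊕ Unit) (Fin n ⊕ Unit) ℝ) (z : Fin n ⊕ Unit → ℝ) :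
    Fin m → ℝ :=
  -((S.qc P)⁻¹ *ᵥ ((S.augQl P)ᵀ *ᵥ z))

variable {S} {P P' : Matrix (Fin n ⊕ Unit) (Fin n ⊕ Unit) ℝ}

theorem augLxx_isSymm (hLxx : S.Lxx.IsSymm) : S.augLxx.IsSymm := by
  unfold augLxx
  refine IsSymm.fromBlocks hLxx ?_ ?_
  · rfl
  · rfl

theorem augCost_aug (hLxx : S.Lxx.IsSymm) (x : Fin n → ℝ) (u : Fin m → ℝ) :
    S.augCost (aug x) u = S.cost x u := by
  rw [augCost, cost, quadVal_fromBlocks, quadVal_aug (augLxx_isSymm hLxx), aug_dotProduct_mulVec,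
    sumElim_dotProduct_sumElim]
  simp only [augLxx, augLxu, toBlocks_fromBlocks₁₁, fromBlocks_apply₁₂, fromBlocks_apply₂₂,
    replicateCol_apply, of_apply, toRows₁_fromRows]
  change _ + 2 * (_ + u ⬝ᵥ S.Lu) + _ = _
  change _ + 2 * (x ⬝ᵥ S.Lx) + _ + _ + _ = _
  ring

theorem augCost_smul (a : ℝ) (z : Fin n ⊕ Unit → ℝ) (u : Fin m → ℝ) :
    S.augCost (a • z) (a • u) = a ^ 2 * S.augCost z u := by
  simp only [augCost, quadVal_vecSmul, mulVec_smul, dotProduct_smul, smul_dotProduct, smul_eq_mul]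
  ring

/-- For last coordinate `s ≠ 0`, scaling by `s` reduces the claim to the original cost; `s = 0`
follows by density and continuity. -/
theorem augCost_nonneg (hLxx : S.Lxx.IsSymm) (hcost : ∀ x u, 0 ≤ S.cost x u)
    (z : Fin n ⊕ Unit → ℝ) (u : Fin m → ℝ) : 0 ≤ S.augCost z u := by
  obtain ⟨x, s, rfl⟩ : ∃ x s, z = Sum.elim x fun _ => s :=
    ⟨z ∘ Sum.inl, z (Sum.inr ()), by ext (i | i) <;> rfl⟩
  have hclosed : IsClosed {s : ℝ | 0 ≤ S.augCost (Sum.elim x fun _ => s) u} := by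
    refine isClosed_le continuous_const ?_
    have hc : Continuous fun s : ℝ => (Sum.elim x fun _ => s : Fin n ⊕ Unit → ℝ) :=
      continuous_pi fun i => by rcases i with i | i <;> simp <;> fun_prop
    unfold augCost quadVal
    fun_prop
  have hsub : ({0}ᶜ : Set ℝ) ⊆ {s : ℝ | 0 ≤ S.augCost (Sum.elim x fun _ => s) u} := by
    intro s hs
    have hs : s ≠ 0 := hs
    have h1 : (Sum.elim x fun _ => s : Fin n ⊕ Unit → ℝ) = s • aug (s⁻¹ • x) := by
      ext (i | i) <;> simp [aug, hs]
    have h2 : u = s • (s⁻¹ • u) := by simp [hs]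
    rw [Set.mem_ofPred_eq, h1, h2, augCost_smul, augCost_aug hLxx]
    exact mul_nonneg (sq_nonneg _) (hcost _ _)
  have h3 := hclosed.closure_subset_iff.2 hsub
  rw [(dense_compl_singleton (0 : ℝ)).closure_eq] at h3
  exact h3 (Set.mem_univ s)

theorem qForm_nonneg (hγ : 0 ≤ S.γ) (hLxx : S.Lxx.IsSymm) (hcost : ∀ x u, 0 ≤ S.cost x u)
    (hP : P.PosSemidef) (z : Fin n ⊕ Unit → ℝ) (u : Fin m → ℝ) : 0 ≤ S.qForm P z u :=
  add_nonneg (augCost_nonneg hLxx hcost z u) (mul_nonneg hγ (hP.quadVal_nonneg _))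

theorem qForm_mono (hγ : 0 ≤ S.γ) (h : ∀ z, quadVal P z ≤ quadVal P' z)
    (z : Fin n ⊕ Unit → ℝ) (u : Fin m → ℝ) : S.qForm P z u ≤ S.qForm P' z u :=
  add_le_add le_rfl (mul_le_mul_of_nonneg_left (h _) hγ)

theorem qForm_eq (hP : P.IsSymm) (z : Fin n ⊕ Unit → ℝ) (u : Fin m → ℝ) :
    S.qForm P z u
      = quadVal (S.augQ P) z + 2 * (z ⬝ᵥ (S.augQl P *ᵥ u)) + quadVal (S.qc P) u := by
  rw [qForm, augCost, quadVal_vecAdd hP, augQ, augQl, qc, quadVal_add, quadVal_add, quadVal_smul,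
    quadVal_smul, quadVal_transpose_mul_mul, quadVal_transpose_mul_mul, add_mulVec,
    dotProduct_add, smul_mulVec, dotProduct_smul, smul_eq_mul, ← mulVec_mulVec, ← mulVec_mulVec,
    dotProduct_mulVec_transpose, dotProduct_comm (P *ᵥ _)]
  ring

theorem augQ_isSymm (hLxx : S.Lxx.IsSymm) (hP : P.IsSymm) : (S.augQ P).IsSymm := by
  have h : (S.augAᵀ * P * S.augA).IsSymm := by
    simp [IsSymm, transpose_mul, hP.eq, Matrix.mul_assoc]
  exact (augLxx_isSymm hLxx).add (h.smul _)

theorem qc_posDef (hγ : 0 ≤ S.γ) (hLuu : S.Luu.PosDef) (hP : P.PosSemidef) :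
    (S.qc P).PosDef := by
  refine hLuu.add_posSemidef (PosSemidef.smul ?_ hγ)
  simpa [conjTranspose_eq_transpose_of_trivial] using hP.conjTranspose_mul_mul_same S.augB

theorem riccati_isSymm (hγ : 0 ≤ S.γ) (hLxx : S.Lxx.IsSymm) (hLuu : S.Luu.PosDef)
    (hP : P.PosSemidef) : (S.riccati P).IsSymm := by
  refine (augQ_isSymm hLxx hP.isSymm).sub ?_
  have h := (qc_posDef hγ hLuu hP).inv.posSemidef.isSymm.eq
  simp [IsSymm, transpose_mul, h, Matrix.mul_assoc]

/-- The central identity: the first term is the minimum over `u`, and the second, being positive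
definite, measures the distance to the only minimizer. -/
theorem qForm_eq_riccati (hγ : 0 ≤ S.γ) (hLuu : S.Luu.PosDef) (hP : P.PosSemidef)
    (z : Fin n ⊕ Unit → ℝ) (u : Fin m → ℝ) :
    S.qForm P z u
      = quadVal (S.riccati P) z + quadVal (S.qc P) (u - S.augPolicy P z) := by
  rw [qForm_eq hP.isSymm, quadVal_complete_square _ _ (qc_posDef hγ hLuu hP), riccati, augPolicy,
    sub_neg_eq_add]

theorem riccati_le_qForm (hγ : 0 ≤ S.γ) (hLuu : S.Luu.PosDef) (hP : P.PosSemidef)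
    (z : Fin n ⊕ Unit → ℝ) (u : Fin m → ℝ) : quadVal (S.riccati P) z ≤ S.qForm P z u := by
  rw [qForm_eq_riccati hγ hLuu hP]
  exact le_add_of_nonneg_right ((qc_posDef hγ hLuu hP).posSemidef.quadVal_nonneg _)

theorem qForm_augPolicy (hγ : 0 ≤ S.γ) (hLuu : S.Luu.PosDef) (hP : P.PosSemidef)
    (z : Fin n ⊕ Unit → ℝ) : S.qForm P z (S.augPolicy P z) = quadVal (S.riccati P) z := by
  rw [qForm_eq_riccati hγ hLuu hP]
  simp [quadVal]

theorem riccati_posSemidef (hγ : 0 ≤ S.γ) (hLxx : S.Lxx.IsSymm) (hLuu : S.Luu.PosDef)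
    (hcost : ∀ x u, 0 ≤ S.cost x u) (hP : P.PosSemidef) : (S.riccati P).PosSemidef := by
  refine posSemidef_of_quadVal_nonneg (riccati_isSymm hγ hLxx hLuu hP) fun z => ?_
  rw [← qForm_augPolicy hγ hLuu hP]
  exact qForm_nonneg hγ hLxx hcost hP _ _

/-- `riccati` is a pointwise minimum over `u` of expressions that are monotone in `P`; testing the
minimum for `P` at the minimizer for `P'` suffices. -/
theorem riccati_mono (hγ : 0 ≤ S.γ) (hLuu : S.Luu.PosDef) (hP : P.PosSemidef)
    (hP' : P'.PosSemidef) (h : ∀ z, quadVal P z ≤ quadVal P' z) (z : Fin n ⊕ Unit → ℝ) :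
    quadVal (S.riccati P) z ≤ quadVal (S.riccati P') z := by
  rw [← qForm_augPolicy hγ hLuu hP']
  exact (riccati_le_qForm hγ hLuu hP _ _).trans (qForm_mono hγ h _ _)

theorem isRiccatiSolution_iff : S.IsRiccatiSolution P ↔ P.PosSemidef ∧ S.riccati P = P :=
  and_congr_right fun _ => eq_comm

theorem qForm_le_qForm_iff (hγ : 0 ≤ S.γ) (hLuu : S.Luu.PosDef) (hP : P.PosSemidef)
    (z : Fin n ⊕ Unit → ℝ) (u : Fin m → ℝ) :
    (∀ w, S.qForm P z u ≤ S.qForm P z w) ↔ u = S.augPolicy P z := by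
  constructor
  · intro h
    by_contra hne
    have h1 := h (S.augPolicy P z)
    rw [qForm_augPolicy hγ hLuu hP, qForm_eq_riccati hγ hLuu hP] at h1
    have h2 := quadVal_pos (qc_posDef hγ hLuu hP) (sub_ne_zero.2 hne)
    linarith
  · rintro rfl w
    rw [qForm_augPolicy hγ hLuu hP]
    exact riccati_le_qForm hγ hLuu hP _ _

/-! ### The closed forms in homogenized variables -/

theorem qStar_eq (hLxx : S.Lxx.IsSymm) (hP : P.IsSymm) (x : Fin n → ℝ) (u : Fin m → ℝ) :
    S.qStar P x u = S.qForm P (aug x) u + S.γ * (P.toBlocks₁₁ * S.cov).trace / (1 - S.γ) := by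
  rw [qStar, qForm_eq hP, quadVal_aug (augQ_isSymm hLxx hP), aug_dotProduct_mulVec, Qquad,
    quadVal_fromBlocks, Qlin, sumElim_dotProduct_sumElim, ql]
  change _ + 2 * (_ + u ⬝ᵥ S.augQl P (Sum.inr ())) + _ + _ = _
  ring

theorem policy_eq (hP : P.IsSymm) (x : Fin n → ℝ) : S.policy P x = S.augPolicy P (aug x) := by
  have key : (S.augQl P)ᵀ *ᵥ aug x = (S.ql P)ᵀ *ᵥ x + (S.Lu + S.γ •
      (S.Bᵀ *ᵥ ((fun i => P (Sum.inl i) (Sum.inr ())) + P.toBlocks₁₁ *ᵥ (S.c + S.mean)))) := by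
    have hrow : (S.augQl P)ᵀ *ᵥ aug x = (S.ql P)ᵀ *ᵥ x + S.augQl P (Sum.inr ()) := by
      ext j
      simp [aug, mulVec, dotProduct, Fintype.sum_sum_type, ql, toRows₁]
    rw [hrow]
    congr 1
    have hsymm : ∀ i j, P i j = P j i := fun i j => hP.apply _ _
    ext j
    -- The last column of `Ã` is `(c + μ, 1)`, which is where the constant term of the feedback
    -- comes from.
    have h1 : ∀ k, (S.augAᵀ * P) (Sum.inr ()) k = (P *ᵥ aug (S.c + S.mean)) k := by
      intro k
      simp [augA, Matrix.mul_apply, mulVec, dotProduct, aug, Fintype.sum_sum_type, hsymm k,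
        mul_comm]
    have h2 : (P *ᵥ aug (S.c + S.mean)) ∘ Sum.inl
        = (fun i => P (Sum.inl i) (Sum.inr ())) + P.toBlocks₁₁ *ᵥ (S.c + S.mean) := by
      ext k
      simp [mulVec, dotProduct, aug, Fintype.sum_sum_type, toBlocks₁₁, add_comm]
    have h3 : S.augQl P (Sum.inr ()) j
        = S.Lu j + S.γ * (S.augAᵀ * P * S.augB) (Sum.inr ()) j := rfl
    rw [← h2, h3, Matrix.mul_apply, Fintype.sum_sum_type]
    simp only [h1, augB, mulVec, dotProduct, fromRows_apply_inl, fromRows_apply_inr,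
      Matrix.zero_apply, mul_zero, Finset.sum_const_zero, add_zero, transpose_apply,
      Function.comp, Pi.add_apply, Pi.smul_apply, smul_eq_mul]
    congr 2
    exact Finset.sum_congr rfl fun i _ => mul_comm _ _
  rw [policy, augPolicy, key]

theorem dyn_eq (x : Fin n → ℝ) (u : Fin m → ℝ) :
    aug (S.A *ᵥ x + S.B *ᵥ u + S.c + S.mean) = S.augA *ᵥ aug x + S.augB *ᵥ u := by
  rw [augA, augB, aug, aug, fromBlocks_mulVec, fromRows_mulVec]
  ext (i | i)
  · simp [mulVec, dotProduct]; ring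
  · simp

end AffineLQ

namespace AffineLQ

variable {n m : ℕ} {S : AffineLQ n m} {P : Matrix (Fin n ⊕ Unit) (Fin n ⊕ Unit) ℝ}

/-! ### Expectations of quadratic functions of the noise -/

/-- `g` is a quadratic polynomial with quadratic part `ξᵀ M ξ`. -/
def HasQuadPart (M : Matrix (Fin n) (Fin n) ℝ) (g : (Fin n → ℝ) → ℝ) : Prop :=
  ∃ (b : Fin n → ℝ) (d : ℝ), ∀ y, g y = quadVal M y + b ⬝ᵥ y + d

theorem HasQuadPart.add_const {M : Matrix (Fin n) (Fin n) ℝ} {g : (Fin n → ℝ) → ℝ}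
    (hg : HasQuadPart M g) (a : ℝ) : HasQuadPart M fun y => g y + a := by
  obtain ⟨b, d, h⟩ := hg
  exact ⟨b, d + a, fun y => by beta_reduce; rw [h]; ring⟩

theorem hasQuadPart_quadVal_aug (hP : P.IsSymm) :
    HasQuadPart P.toBlocks₁₁ fun y => quadVal P (aug y) :=
  ⟨(2 : ℝ) • fun i => P (Sum.inl i) (Sum.inr ()), P (Sum.inr ()) (Sum.inr ()), fun y => by
    beta_reduce
    rw [quadVal_aug hP, smul_dotProduct, dotProduct_comm y, smul_eq_mul]⟩

theorem hasQuadPart_qForm (hLxx : S.Lxx.IsSymm) (hP : P.IsSymm) (w : Fin m → ℝ) :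
    HasQuadPart (S.augQ P).toBlocks₁₁ fun y => S.qForm P (aug y) w :=
  ⟨(2 : ℝ) • ((fun i => S.augQ P (Sum.inl i) (Sum.inr ())) + (S.augQl P).toRows₁ *ᵥ w),
    S.augQ P (Sum.inr ()) (Sum.inr ()) + 2 * (w ⬝ᵥ S.augQl P (Sum.inr ())) + quadVal (S.qc P) w,
    fun y => by
      beta_reduce
      rw [qForm_eq hP, quadVal_aug (augQ_isSymm hLxx hP), aug_dotProduct_mulVec, smul_dotProduct,
        add_dotProduct, dotProduct_comm y, dotProduct_comm y, smul_eq_mul]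
      ring⟩

theorem quadVal_eq_sum (M : Matrix (Fin n) (Fin n) ℝ) (y : Fin n → ℝ) :
    quadVal M y = ∑ i, ∑ j, M i j * (y i * y j) := by
  simp only [quadVal, dotProduct, mulVec, Finset.mul_sum]
  exact Finset.sum_congr rfl fun i _ => Finset.sum_congr rfl fun j _ => by ring

section Noise

variable [IsProbabilityMeasure S.noise]

theorem integrable_noise (hnoise : ∀ i, MemLp (fun ξ : Fin n → ℝ => ξ i) 2 S.noise) (i : Fin n) :
    Integrable (fun ξ : Fin n → ℝ => ξ i) S.noise :=
  (hnoise i).integrable (by norm_num)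

theorem integral_add_noise (hnoise : ∀ i, MemLp (fun ξ : Fin n → ℝ => ξ i) 2 S.noise)
    (y : Fin n → ℝ) (i : Fin n) :
    Integrable (fun ξ => (y + ξ) i) S.noise ∧ ∫ ξ, (y + ξ) i ∂S.noise = (y + S.mean) i := by
  have h := integrable_noise hnoise i
  refine ⟨(integrable_const _).add h, ?_⟩
  simp only [Pi.add_apply]
  rw [integral_add (integrable_const _) h]
  simp [mean]

theorem integral_mul_noise (hnoise : ∀ i, MemLp (fun ξ : Fin n → ℝ => ξ i) 2 S.noise)
    (y : Fin n → ℝ) (i j : Fin n) :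
    Integrable (fun ξ => (y + ξ) i * (y + ξ) j) S.noise ∧
      ∫ ξ, (y + ξ) i * (y + ξ) j ∂S.noise = (y + S.mean) i * (y + S.mean) j + S.cov i j := by
  have hm : ∀ i, MemLp (fun ξ : Fin n → ℝ => ξ i - S.mean i) 2 S.noise :=
    fun i => (hnoise i).sub (memLp_const _)
  have hi : ∀ i, Integrable (fun ξ : Fin n → ℝ => ξ i - S.mean i) S.noise :=
    fun i => (hm i).integrable (by norm_num)
  have h0 : ∀ i, ∫ ξ, (ξ i - S.mean i) ∂S.noise = 0 := fun i => by
    rw [integral_sub (integrable_noise hnoise i) (integrable_const _)]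
    simp [mean]
  have hij : Integrable (fun ξ : Fin n → ℝ => (ξ i - S.mean i) * (ξ j - S.mean j)) S.noise :=
    (hm i).integrable_mul (hm j)
  -- Expanding around the mean makes both mixed terms integrate to zero.
  have hexp : (fun ξ : Fin n → ℝ => (y + ξ) i * (y + ξ) j) = fun ξ =>
      (y + S.mean) i * (y + S.mean) j + (y + S.mean) i * (ξ j - S.mean j)
        + (y + S.mean) j * (ξ i - S.mean i) + (ξ i - S.mean i) * (ξ j - S.mean j) := by
    funext ξ; simp only [Pi.add_apply]; ring
  have i1 : Integrable (fun _ : Fin n → ℝ => (y + S.mean) i * (y + S.mean) j) S.noise :=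
    integrable_const _
  have i2 := i1.add ((hi j).const_mul ((y + S.mean) i))
  have i3 := i2.add ((hi i).const_mul ((y + S.mean) j))
  have i4 := i3.add hij
  rw [hexp]
  refine ⟨i4, ?_⟩
  have e4 := integral_add i3 hij
  have e3 := integral_add i2 ((hi i).const_mul ((y + S.mean) j))
  have e2 := integral_add i1 ((hi j).const_mul ((y + S.mean) i))
  simp only [Pi.add_apply] at e2 e3 e4 ⊢
  rw [e4, e3, e2, integral_const_mul (y i + S.mean i) fun ξ : Fin n → ℝ => ξ j - S.mean j,
    integral_const_mul (y j + S.mean j) fun ξ : Fin n → ℝ => ξ i - S.mean i, h0, h0]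
  simp [cov]

theorem integral_quadVal_add_noise (hnoise : ∀ i, MemLp (fun ξ : Fin n → ℝ => ξ i) 2 S.noise)
    (M : Matrix (Fin n) (Fin n) ℝ) (y : Fin n → ℝ) :
    Integrable (fun ξ => quadVal M (y + ξ)) S.noise ∧
      ∫ ξ, quadVal M (y + ξ) ∂S.noise = quadVal M (y + S.mean) + (M * S.cov).trace := by
  simp_rw [quadVal_eq_sum]
  have h : ∀ i j, Integrable (fun ξ => M i j * ((y + ξ) i * (y + ξ) j)) S.noise :=
    fun i j => (integral_mul_noise hnoise y i j).1.const_mul _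
  refine ⟨integrable_finsetSum _ fun i _ => integrable_finsetSum _ fun j _ => h i j, ?_⟩
  rw [integral_finsetSum _ fun i _ => integrable_finsetSum _ fun j _ => h i j]
  simp_rw [fun i => integral_finsetSum Finset.univ fun j _ => h i j, integral_const_mul,
    fun i j => (integral_mul_noise hnoise y i j).2, mul_add, Finset.sum_add_distrib]
  congr 1
  simp only [trace, diag, Matrix.mul_apply]
  refine Finset.sum_congr rfl fun i _ => Finset.sum_congr rfl fun j _ => ?_
  congr 1
  -- The trace pairs `M i j` with the transposed covariance entry, so symmetry of the covariance is
  -- needed.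
  simp only [cov, of_apply]
  exact integral_congr_ae (.of_forall fun ξ => mul_comm _ _)

/-- The trace is the expectation of the nonnegative form `M` at the centred noise, obtained by
shifting with `-S.mean`. -/
theorem trace_mul_cov_nonneg (hnoise : ∀ i, MemLp (fun ξ : Fin n → ℝ => ξ i) 2 S.noise)
    {M : Matrix (Fin n) (Fin n) ℝ} (hM : M.PosSemidef) : 0 ≤ (M * S.cov).trace := by
  have h := (integral_quadVal_add_noise hnoise M (-S.mean)).2
  have h0 : quadVal M (-S.mean + S.mean) = 0 := by simp [quadVal]
  rw [h0, zero_add] at h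
  rw [← h]
  exact integral_nonneg fun ξ => hM.quadVal_nonneg _

theorem HasQuadPart.integral_dyn (hnoise : ∀ i, MemLp (fun ξ : Fin n → ℝ => ξ i) 2 S.noise)
    {M : Matrix (Fin n) (Fin n) ℝ} {g : (Fin n → ℝ) → ℝ} (hg : HasQuadPart M g)
    (x : Fin n → ℝ) (u : Fin m → ℝ) :
    Integrable (fun ξ => g (S.dyn x u ξ)) S.noise ∧
      ∫ ξ, g (S.dyn x u ξ) ∂S.noise
        = g (S.A *ᵥ x + S.B *ᵥ u + S.c + S.mean) + (M * S.cov).trace := by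
  obtain ⟨b, d, h⟩ := hg
  simp_rw [h, dyn]
  set y := S.A *ᵥ x + S.B *ᵥ u + S.c
  obtain ⟨i1, e1⟩ := integral_quadVal_add_noise hnoise M y
  have i2 : Integrable (fun ξ => b ⬝ᵥ (y + ξ)) S.noise :=
    integrable_finsetSum _ fun i _ => (integral_add_noise hnoise y i).1.const_mul _
  have e2 : ∫ ξ, b ⬝ᵥ (y + ξ) ∂S.noise = b ⬝ᵥ (y + S.mean) := by
    simp only [dotProduct]
    rw [integral_finsetSum _ fun i _ => (integral_add_noise hnoise y i).1.const_mul _]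
    simp_rw [integral_const_mul, fun i => (integral_add_noise hnoise y i).2]
  refine ⟨(i1.add i2).add (integrable_const d), ?_⟩
  have e := integral_add (i1.add i2) (integrable_const (μ := S.noise) d)
  have e' := integral_add i1 i2
  simp only [Pi.add_apply] at e e'
  rw [e, e', e1, e2]
  simp
  ring

/-- The averaging step of `F`: the control has already been minimized out, so the trace sees the
block of `P`. -/
theorem cost_add_integral_quadVal (hLxx : S.Lxx.IsSymm)
    (hnoise : ∀ i, MemLp (fun ξ : Fin n → ℝ => ξ i) 2 S.noise) (hP : P.IsSymm) (a : ℝ)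
    (x : Fin n → ℝ) (u : Fin m → ℝ) :
    Integrable (fun ξ => quadVal P (aug (S.dyn x u ξ)) + a) S.noise ∧
      S.cost x u + S.γ * ∫ ξ, (quadVal P (aug (S.dyn x u ξ)) + a) ∂S.noise
        = S.qForm P (aug x) u + S.γ * (a + (P.toBlocks₁₁ * S.cov).trace) := by
  obtain ⟨h1, h2⟩ := ((hasQuadPart_quadVal_aug hP).add_const a).integral_dyn hnoise x u
  refine ⟨h1, ?_⟩
  rw [h2, dyn_eq, qForm, augCost_aug hLxx]
  ring

/-- The averaging step of `F̂`: the next control `w` is still fixed, so the trace sees the block of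
`augQ P`. -/
theorem integral_qForm (hLxx : S.Lxx.IsSymm)
    (hnoise : ∀ i, MemLp (fun ξ : Fin n → ℝ => ξ i) 2 S.noise) (hP : P.IsSymm) (a : ℝ)
    (x : Fin n → ℝ) (u w : Fin m → ℝ) :
    Integrable (fun ξ => S.qForm P (aug (S.dyn x u ξ)) w + a) S.noise ∧
      ∫ ξ, (S.qForm P (aug (S.dyn x u ξ)) w + a) ∂S.noise
        = S.qForm P (S.augA *ᵥ aug x + S.augB *ᵥ u) w
          + (a + ((S.augQ P).toBlocks₁₁ * S.cov).trace) := by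
  obtain ⟨h1, h2⟩ := ((hasQuadPart_qForm (S := S) hLxx hP w).add_const a).integral_dyn hnoise x u
  refine ⟨h1, ?_⟩
  rw [h2, dyn_eq]
  ring

end Noise

end AffineLQ

/-! ### Quadratic growth -/

theorem mul_self_le_dotProduct_self {ι : Type*} [Fintype ι] (v : ι → ℝ) (i : ι) :
    v i * v i ≤ v ⬝ᵥ v :=
  Finset.single_le_sum (f := fun i => v i * v i) (fun _ _ => mul_self_nonneg _)
    (Finset.mem_univ i)

theorem dotProduct_self_nonneg_real {ι : Type*} [Fintype ι] (v : ι → ℝ) : 0 ≤ v ⬝ᵥ v :=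
  Finset.sum_nonneg fun _ _ => mul_self_nonneg _

theorem exists_abs_dotProduct_mulVec_le {ι κ : Type*} [Fintype ι] [Fintype κ]
    (Y : Matrix ι κ ℝ) :
    ∃ C, 0 ≤ C ∧ ∀ z u, |z ⬝ᵥ (Y *ᵥ u)| ≤ C * (z ⬝ᵥ z + u ⬝ᵥ u) := by
  refine ⟨∑ i, ∑ j, |Y i j|, by positivity, fun z u => ?_⟩
  simp only [Finset.sum_mul]
  have h : z ⬝ᵥ (Y *ᵥ u) = ∑ i, ∑ j, z i * (Y i j * u j) := by
    simp [dotProduct, mulVec, Finset.mul_sum]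
  rw [h]
  refine (Finset.abs_sum_le_sum_abs _ _).trans (Finset.sum_le_sum fun i _ =>
    (Finset.abs_sum_le_sum_abs _ _).trans (Finset.sum_le_sum fun j _ => ?_))
  have h1 : |z i * (Y i j * u j)| = |Y i j| * (|z i| * |u j|) := by
    rw [abs_mul, abs_mul]; ring
  rw [h1]
  refine mul_le_mul_of_nonneg_left ?_ (abs_nonneg _)
  have h2 := mul_self_le_dotProduct_self z i
  have h3 := mul_self_le_dotProduct_self u j
  nlinarith [sq_nonneg (|z i| - |u j|), abs_mul_abs_self (z i), abs_mul_abs_self (u j),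
    mul_self_nonneg (z i), mul_self_nonneg (u j)]

namespace AffineLQ

variable {n m : ℕ} {S : AffineLQ n m} {P P' : Matrix (Fin n ⊕ Unit) (Fin n ⊕ Unit) ℝ}

theorem continuous_aug : Continuous (aug : (Fin n → ℝ) → _) :=
  continuous_pi fun i => by rcases i with i | i <;> simp [aug] <;> fun_prop

theorem aug_dotProduct_self (x : Fin n → ℝ) : aug x ⬝ᵥ aug x = 1 + x ⬝ᵥ x := by
  simp [aug, add_comm, dotProduct]

theorem continuous_qForm :
    Continuous fun p : (Fin n → ℝ) × (Fin m → ℝ) => S.qForm P (aug p.1) p.2 := by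
  have h1 := continuous_aug (n := n)
  unfold qForm augCost quadVal
  fun_prop

theorem quadGrowth_qForm (hP : P.IsSymm) (a : ℝ) :
    QuadGrowth fun x u => S.qForm P (aug x) u + a := by
  refine ⟨(continuous_qForm.add continuous_const).measurable, ?_⟩
  obtain ⟨C₁, h₁, H₁⟩ := exists_abs_dotProduct_mulVec_le (S.augQ P)
  obtain ⟨C₂, h₂, H₂⟩ := exists_abs_dotProduct_mulVec_le (S.augQl P)
  obtain ⟨C₃, h₃, H₃⟩ := exists_abs_dotProduct_mulVec_le (S.qc P)
  refine ⟨2 * C₁ + 2 * C₂ + 2 * C₃ + |a|, fun x u => ?_⟩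
  beta_reduce
  rw [qForm_eq hP]
  have hx : 0 ≤ x ⬝ᵥ x := dotProduct_self_nonneg_real x
  have hu : 0 ≤ u ⬝ᵥ u := dotProduct_self_nonneg_real u
  have e₁ := H₁ (aug x) (aug x)
  have e₂ := H₂ (aug x) u
  have e₃ := H₃ u u
  simp only [aug_dotProduct_self] at e₁ e₂ e₃
  simp only [quadVal]
  set b := aug x ⬝ᵥ (S.augQ P *ᵥ aug x)
  set c := aug x ⬝ᵥ (S.augQl P *ᵥ u)
  set d := u ⬝ᵥ (S.qc P *ᵥ u)
  have ht : |b + 2 * c + d + a| ≤ |b| + 2 * |c| + |d| + |a| := by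
    have := abs_add_le (b + 2 * c + d) a
    have := abs_add_le (b + 2 * c) d
    have := abs_add_le b (2 * c)
    have : |2 * c| = 2 * |c| := by rw [abs_mul, abs_two]
    linarith
  have k₁ := mul_nonneg h₁ hu
  have k₃ := mul_nonneg h₃ hx
  have k₄ := mul_nonneg (abs_nonneg a) hx
  have k₅ := mul_nonneg (abs_nonneg a) hu
  linarith

/-! ### Fixed points from Riccati solutions -/

/-- The upper left block of the Riccati equation; the extra term is the matrix appearing in `gap`.
-/
theorem augQ_toBlocks₁₁ (hric : S.riccati P = P) :
    (S.augQ P).toBlocks₁₁ = P.toBlocks₁₁ + S.ql P * (S.qc P)⁻¹ * (S.ql P)ᵀ := by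
  have h1 : S.augQ P = P + S.augQl P * (S.qc P)⁻¹ * (S.augQl P)ᵀ :=
    sub_eq_iff_eq_add.1 hric
  have h2 : ∀ i j, S.augQ P (Sum.inl i) (Sum.inl j) = P (Sum.inl i) (Sum.inl j)
      + (S.augQl P * (S.qc P)⁻¹ * (S.augQl P)ᵀ) (Sum.inl i) (Sum.inl j) :=
    fun i j => congrFun (congrFun h1 (Sum.inl i)) (Sum.inl j)
  ext i j
  exact h2 i j

theorem qHat_eq (hLxx : S.Lxx.IsSymm) (hP : P.IsSymm) (hric : S.riccati P = P)
    (x : Fin n → ℝ) (u : Fin m → ℝ) :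
    S.qHat P x u = S.qForm P (aug x) u
      + S.γ * ((S.augQ P).toBlocks₁₁ * S.cov).trace / (1 - S.γ) := by
  rw [qHat, qStar_eq hLxx hP, gap, augQ_toBlocks₁₁ hric, Matrix.add_mul, trace_add]
  ring

theorem bddBelow_range_qForm (hγ : 0 ≤ S.γ) (hLuu : S.Luu.PosDef) (hP : P.PosSemidef) (a : ℝ)
    (z : Fin n ⊕ Unit → ℝ) : BddBelow (Set.range fun w => S.qForm P z w + a) :=
  ⟨quadVal (S.riccati P) z + a, by
    rintro _ ⟨w, rfl⟩
    exact add_le_add (riccati_le_qForm hγ hLuu hP _ _) le_rfl⟩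

theorem iInf_qForm (hγ : 0 ≤ S.γ) (hLuu : S.Luu.PosDef) (hP : P.PosSemidef) (a : ℝ)
    (z : Fin n ⊕ Unit → ℝ) : ⨅ w, (S.qForm P z w + a) = quadVal (S.riccati P) z + a := by
  refine le_antisymm ?_ (le_ciInf fun w =>
    add_le_add (riccati_le_qForm hγ hLuu hP _ _) le_rfl)
  refine (ciInf_le (bddBelow_range_qForm hγ hLuu hP a z) (S.augPolicy P z)).trans ?_
  rw [qForm_augPolicy hγ hLuu hP]

section Noise

variable [IsProbabilityMeasure S.noise]

theorem isBellmanFixedPoint_qForm (hγ : 0 ≤ S.γ) (hγ₁ : S.γ < 1) (hLxx : S.Lxx.IsSymm)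
    (hLuu : S.Luu.PosDef) (hnoise : ∀ i, MemLp (fun ξ : Fin n → ℝ => ξ i) 2 S.noise)
    (hP : P.PosSemidef) (hric : S.riccati P = P) :
    S.IsBellmanFixedPoint fun x u =>
      S.qForm P (aug x) u + S.γ * (P.toBlocks₁₁ * S.cov).trace / (1 - S.γ) := by
  have h1 : 1 - S.γ ≠ 0 := by linarith
  refine ⟨fun x => bddBelow_range_qForm hγ hLuu hP _ _, fun x u => ?_, fun x u => ?_⟩
  · simp_rw [iInf_qForm hγ hLuu hP, hric]
    exact (cost_add_integral_quadVal hLxx hnoise hP.isSymm _ x u).1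
  · rw [bellman]
    simp_rw [iInf_qForm hγ hLuu hP, hric]
    rw [(cost_add_integral_quadVal hLxx hnoise hP.isSymm _ x u).2]
    -- The additive constant solves `a = γ (a + τ)`.
    field_simp
    ring

theorem isRelaxedFixedPoint_qForm (hγ : 0 ≤ S.γ) (hγ₁ : S.γ < 1) (hLxx : S.Lxx.IsSymm)
    (hLuu : S.Luu.PosDef) (hnoise : ∀ i, MemLp (fun ξ : Fin n → ℝ => ξ i) 2 S.noise)
    (hP : P.PosSemidef) (hric : S.riccati P = P) :
    S.IsRelaxedFixedPoint fun x u =>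
      S.qForm P (aug x) u + S.γ * ((S.augQ P).toBlocks₁₁ * S.cov).trace / (1 - S.γ) := by
  have h1 : 1 - S.γ ≠ 0 := by linarith
  refine ⟨fun x u w => (integral_qForm hLxx hnoise hP.isSymm _ x u w).1, fun x u => ?_,
    fun x u => ?_⟩
  · simp_rw [fun w => (integral_qForm hLxx hnoise hP.isSymm
      (S.γ * ((S.augQ P).toBlocks₁₁ * S.cov).trace / (1 - S.γ)) x u w).2]
    exact bddBelow_range_qForm hγ hLuu hP _ _
  · rw [relaxedBellman]
    simp_rw [fun w => (integral_qForm hLxx hnoise hP.isSymm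
      (S.γ * ((S.augQ P).toBlocks₁₁ * S.cov).trace / (1 - S.γ)) x u w).2]
    rw [iInf_qForm hγ hLuu hP, hric, qForm, augCost_aug hLxx]
    field_simp
    ring

theorem gap_nonneg (hγ : 0 ≤ S.γ) (hγ₁ : S.γ < 1) (hLuu : S.Luu.PosDef)
    (hnoise : ∀ i, MemLp (fun ξ : Fin n → ℝ => ξ i) 2 S.noise) (hP : P.PosSemidef) :
    0 ≤ S.gap P := by
  refine div_nonneg (mul_nonneg hγ (trace_mul_cov_nonneg hnoise ?_)) (by linarith)
  simpa [conjTranspose_eq_transpose_of_trivial] using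
    (qc_posDef hγ hLuu hP).inv.posSemidef.mul_mul_conjTranspose_same (S.ql P)

theorem trace_toBlocks_mul_cov_nonneg
    (hnoise : ∀ i, MemLp (fun ξ : Fin n → ℝ => ξ i) 2 S.noise) (hP : P.PosSemidef) :
    0 ≤ (P.toBlocks₁₁ * S.cov).trace :=
  trace_mul_cov_nonneg hnoise (hP.submatrix Sum.inl)

/-! ### Value iteration bounds on fixed points -/

/-- Monotonicity of the operator carries a bound of the form `qForm P + a` to the next Riccati
iterate. The three companion lemmas rest on the same principle. -/
theorem bellman_lower_step (hγ : 0 ≤ S.γ) (hLxx : S.Lxx.IsSymm)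
    (hLuu : S.Luu.PosDef) (hnoise : ∀ i, MemLp (fun ξ : Fin n → ℝ => ξ i) 2 S.noise)
    {q : (Fin n → ℝ) → (Fin m → ℝ) → ℝ} (hq : S.IsBellmanFixedPoint q) (hP : P.PosSemidef)
    {a : ℝ} (h : ∀ x u, S.qForm P (aug x) u + a ≤ q x u) (x : Fin n → ℝ) (u : Fin m → ℝ) :
    S.qForm (S.riccati P) (aug x) u
      + S.γ * (a + ((S.riccati P).toBlocks₁₁ * S.cov).trace) ≤ q x u := by
  obtain ⟨h1, h2⟩ := cost_add_integral_quadVal hLxx hnoise (riccati_isSymm hγ hLxx hLuu hP) a x u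
  rw [← h2, ← hq.2.2 x u, bellman]
  gcongr
  · exact hq.2.1 x u
  · intro ξ
    exact le_ciInf fun w => (add_le_add (riccati_le_qForm hγ hLuu hP _ w) le_rfl).trans (h _ _)

theorem bellman_upper_step (hγ : 0 ≤ S.γ) (hLxx : S.Lxx.IsSymm)
    (hLuu : S.Luu.PosDef) (hnoise : ∀ i, MemLp (fun ξ : Fin n → ℝ => ξ i) 2 S.noise)
    {q : (Fin n → ℝ) → (Fin m → ℝ) → ℝ} (hq : S.IsBellmanFixedPoint q) (hP : P.PosSemidef)
    {a : ℝ} (h : ∀ x u, q x u ≤ S.qForm P (aug x) u + a) (x : Fin n → ℝ) (u : Fin m → ℝ) :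
    q x u ≤ S.qForm (S.riccati P) (aug x) u
      + S.γ * (a + ((S.riccati P).toBlocks₁₁ * S.cov).trace) := by
  obtain ⟨h1, h2⟩ := cost_add_integral_quadVal hLxx hnoise (riccati_isSymm hγ hLxx hLuu hP) a x u
  rw [← h2, ← hq.2.2 x u, bellman]
  gcongr
  · exact hq.2.1 x u
  · intro ξ
    refine (ciInf_le (hq.1 _) (S.augPolicy P (aug (S.dyn x u ξ)))).trans ((h _ _).trans ?_)
    rw [qForm_augPolicy hγ hLuu hP]

theorem relaxed_lower_step (hγ : 0 ≤ S.γ) (hLxx : S.Lxx.IsSymm)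
    (hLuu : S.Luu.PosDef) (hnoise : ∀ i, MemLp (fun ξ : Fin n → ℝ => ξ i) 2 S.noise)
    {q : (Fin n → ℝ) → (Fin m → ℝ) → ℝ} (hq : S.IsRelaxedFixedPoint q) (hP : P.PosSemidef)
    {a : ℝ} (h : ∀ x u, S.qForm P (aug x) u + a ≤ q x u) (x : Fin n → ℝ) (u : Fin m → ℝ) :
    S.qForm (S.riccati P) (aug x) u
      + S.γ * (a + ((S.augQ P).toBlocks₁₁ * S.cov).trace) ≤ q x u := by
  rw [← hq.2.2 x u, relaxedBellman, qForm, augCost_aug hLxx, add_assoc, ← mul_add]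
  gcongr
  refine le_ciInf fun w => ?_
  obtain ⟨h1, h2⟩ := integral_qForm hLxx hnoise hP.isSymm a x u w
  refine (add_le_add (riccati_le_qForm hγ hLuu hP _ w) le_rfl).trans ?_
  rw [← h2]
  exact integral_mono h1 (hq.1 x u w) fun ξ => h _ _

theorem relaxed_upper_step (hγ : 0 ≤ S.γ) (hLxx : S.Lxx.IsSymm)
    (hLuu : S.Luu.PosDef) (hnoise : ∀ i, MemLp (fun ξ : Fin n → ℝ => ξ i) 2 S.noise)
    {q : (Fin n → ℝ) → (Fin m → ℝ) → ℝ} (hq : S.IsRelaxedFixedPoint q) (hP : P.PosSemidef)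
    {a : ℝ} (h : ∀ x u, q x u ≤ S.qForm P (aug x) u + a) (x : Fin n → ℝ) (u : Fin m → ℝ) :
    q x u ≤ S.qForm (S.riccati P) (aug x) u
      + S.γ * (a + ((S.augQ P).toBlocks₁₁ * S.cov).trace) := by
  rw [← hq.2.2 x u, relaxedBellman, qForm, augCost_aug hLxx, add_assoc, ← mul_add]
  gcongr
  -- In `F̂` the control is chosen before the noise is seen, so the minimizing feedback is evaluated
  -- at the mean successor state.
  set w := S.augPolicy P (S.augA *ᵥ aug x + S.augB *ᵥ u) with hw
  refine (ciInf_le (hq.2.1 x u) w).trans ?_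
  obtain ⟨h1, h2⟩ := integral_qForm hLxx hnoise hP.isSymm a x u w
  refine (integral_mono (hq.1 x u w) h1 fun ξ => h _ _).trans ?_
  rw [h2, hw, qForm_augPolicy hγ hLuu hP]

end Noise

/-! ### Recovering the Riccati solution from the value function -/

/-- Even and odd parts in `x` separate the quadratic and linear blocks. The corner entry is only
determined up to the additive constant, hence the hypothesis `a = a'` in the second claim. -/
theorem eq_of_quadVal_aug_eq (hP : P.IsSymm) (hP' : P'.IsSymm) {a a' : ℝ}
    (h : ∀ x, quadVal P (aug x) + a = quadVal P' (aug x) + a') :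
    P.toBlocks₁₁ = P'.toBlocks₁₁ ∧ (a = a' → P = P') := by
  have key : ∀ x : Fin n → ℝ, quadVal P.toBlocks₁₁ x = quadVal P'.toBlocks₁₁ x ∧
      (x ⬝ᵥ fun i => P (Sum.inl i) (Sum.inr ())) = x ⬝ᵥ fun i => P' (Sum.inl i) (Sum.inr ()) := by
    intro x
    have h1 := h x
    have h2 := h (-x)
    have h3 := h 0
    have hn : ∀ M : Matrix (Fin n) (Fin n) ℝ, quadVal M (-x) = quadVal M x := fun M => by
      simp [quadVal, mulVec_neg]
    have h0 : ∀ M : Matrix (Fin n) (Fin n) ℝ, quadVal M 0 = 0 := fun M => by simp [quadVal]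
    simp only [quadVal_aug hP, quadVal_aug hP', hn, h0, neg_dotProduct, zero_dotProduct] at h1 h2 h3
    constructor <;> linarith
  have h11 : P.toBlocks₁₁ = P'.toBlocks₁₁ :=
    eq_of_quadVal_eq (hP.submatrix Sum.inl) (hP'.submatrix Sum.inl) fun x => (key x).1
  refine ⟨h11, fun ha => eq_of_quadVal_eq hP hP' fun z => ?_⟩
  obtain ⟨x, s, rfl⟩ : ∃ x s, z = Sum.elim x fun _ => s :=
    ⟨z ∘ Sum.inl, z (Sum.inr ()), by ext (i | i) <;> rfl⟩
  have h3 := h 0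
  simp only [quadVal_aug hP, quadVal_aug hP', ha, zero_dotProduct, h11] at h3
  rw [quadVal_sumElim hP, quadVal_sumElim hP', h11, (key x).2]
  have h4 : P (Sum.inr ()) (Sum.inr ()) = P' (Sum.inr ()) (Sum.inr ()) := by linarith
  rw [h4]

theorem quadVal_aug_eq_of_qForm_eq (hγ : 0 ≤ S.γ) (hLuu : S.Luu.PosDef)
    (hP : P.PosSemidef) (hric : S.riccati P = P) (hP' : P'.PosSemidef) (hric' : S.riccati P' = P')
    {a a' : ℝ} (h : ∀ x u, S.qForm P (aug x) u + a = S.qForm P' (aug x) u + a')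
    (x : Fin n → ℝ) : quadVal P (aug x) + a = quadVal P' (aug x) + a' := by
  have h1 := iInf_qForm hγ hLuu hP a (aug x)
  simp_rw [h] at h1
  rw [iInf_qForm hγ hLuu hP', hric, hric'] at h1
  exact h1.symm

/-- The zero blocks of `Ã` and `B̃` keep the other blocks of `P` out. Together with `qc_congr`, this
makes the constant of `F̂` a function of the upper left block at Riccati solutions. -/
theorem ql_congr (h : P.toBlocks₁₁ = P'.toBlocks₁₁) : S.ql P = S.ql P' := by
  have key : ∀ P, S.ql P = S.Lxu + S.γ • (S.Aᵀ * P.toBlocks₁₁ * S.B) := by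
    intro P
    have h1 : S.augAᵀ * P * S.augB
        = fromRows (S.Aᵀ * P.toBlocks₁₁ * S.B) (replicateRow Unit (S.c + S.mean) * P.toBlocks₁₁ * S.B
          + P.toBlocks₂₁ * S.B) := by
      conv_lhs => rw [← fromBlocks_toBlocks P]
      rw [augA, augB, fromBlocks_transpose, fromBlocks_multiply, fromBlocks_mul_fromRows]
      simp [Matrix.add_mul]
    rw [ql, augQl, h1, augLxu]
    ext i j
    rfl
  rw [key, key, h]

theorem qc_congr (h : P.toBlocks₁₁ = P'.toBlocks₁₁) : S.qc P = S.qc P' := by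
  have key : ∀ P, S.qc P = S.Luu + S.γ • (S.Bᵀ * P.toBlocks₁₁ * S.B) := by
    intro P
    rw [qc, augB]
    conv_lhs => rw [← fromBlocks_toBlocks P]
    rw [transpose_fromRows, fromCols_mul_fromBlocks, fromCols_mul_fromRows]
    simp
  rw [key, key, h]

end AffineLQ

/-! ### Stability and Lyapunov inequalities -/

/-- Gelfand's formula: for `r` strictly between the spectral radius and 1, eventually `‖a ^ k‖ ≤ r ^
k`. -/
theorem tendsto_pow_zero_of_spectrum_lt_one {A : Type*} [NormedRing A] [NormedAlgebra ℂ A]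
    [CompleteSpace A] [Nontrivial A] (a : A) (h : ∀ z ∈ spectrum ℂ a, ‖z‖ < 1) :
    Tendsto (fun k => a ^ k) atTop (𝓝 0) := by
  have h1 : spectralRadius ℂ a < ((1 : NNReal) : ENNReal) :=
    spectrum.spectralRadius_lt_of_forall_lt a fun z hz => by
      have := h z hz
      exact_mod_cast this
  obtain ⟨r, hr, hr1⟩ := ENNReal.lt_iff_exists_nnreal_btwn.1 h1
  have hr1 : r < 1 := by exact_mod_cast hr1
  have h2 := (spectrum.pow_nnnorm_pow_one_div_tendsto_nhds_spectralRadius a).eventually_lt_const hr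
  refine squeeze_zero_norm' (a := fun k => (r : ℝ) ^ k) ?_
    (tendsto_pow_atTop_nhds_zero_of_lt_one r.2 (by exact_mod_cast hr1))
  filter_upwards [h2, eventually_gt_atTop 0] with k hk hk0
  have hk0' : (0 : ℝ) < k := by exact_mod_cast hk0
  have h3 := ENNReal.rpow_le_rpow hk.le hk0'.le
  rw [← ENNReal.rpow_mul, one_div, inv_mul_cancel₀ hk0'.ne', ENNReal.rpow_one,
    ENNReal.rpow_natCast] at h3
  have h4 : ‖a ^ k‖₊ ≤ r ^ k := by exact_mod_cast h3
  exact_mod_cast h4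

section Matrices

attribute [local instance] Matrix.linftyOpNormedRing Matrix.linftyOpNormedAlgebra

theorem Matrix.tendsto_pow_zero_of_spectrum_lt_one {ι : Type*} [Fintype ι] [DecidableEq ι]
    [Nonempty ι] (M : Matrix ι ι ℝ)
    (h : ∀ z ∈ spectrum ℂ (M.map (algebraMap ℝ ℂ)), ‖z‖ < 1) (i j : ι) :
    Tendsto (fun k => (M ^ k) i j) atTop (𝓝 0) := by
  have h1 := _root_.tendsto_pow_zero_of_spectrum_lt_one (M.map (algebraMap ℝ ℂ)) h
  have h2 : Continuous fun X : Matrix ι ι ℂ => (X i j).re :=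
    Complex.continuous_re.comp (continuous_id.matrix_elem i j)
  have h3 := (h2.tendsto 0).comp h1
  have h4 : ∀ k, (M.map (algebraMap ℝ ℂ)) ^ k = (M ^ k).map (algebraMap ℝ ℂ) := fun k => by
    have := map_pow (algebraMap ℝ ℂ).mapMatrix M k
    simpa [RingHom.mapMatrix_apply] using this.symm
  simp_rw [Function.comp_def, h4] at h3
  simpa using h3

end Matrices

theorem mulVec_dotProduct_self_le {ι : Type*} [Fintype ι] (M : Matrix ι ι ℝ) (z : ι → ℝ) :
    (M *ᵥ z) ⬝ᵥ (M *ᵥ z) ≤ (∑ i, ∑ j, M i j ^ 2) * (z ⬝ᵥ z) := by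
  rw [dotProduct, Finset.sum_mul]
  refine Finset.sum_le_sum fun i _ => ?_
  have h := Finset.sum_mul_sq_le_sq_mul_sq Finset.univ (M i) z
  have h' : z ⬝ᵥ z = ∑ j, z j ^ 2 := Finset.sum_congr rfl fun j _ => by ring
  rw [h', ← sq]
  exact h

section Lyapunov

variable {ι : Type*} [Fintype ι] [DecidableEq ι]

theorem exists_pow_contraction [Nonempty ι] (M : Matrix ι ι ℝ)
    (h : ∀ z ∈ spectrum ℂ (M.map (algebraMap ℝ ℂ)), ‖z‖ < 1) :
    ∃ N, ∀ z, ((M ^ N) *ᵥ z) ⬝ᵥ ((M ^ N) *ᵥ z) ≤ 1 / 2 * (z ⬝ᵥ z) := by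
  have h1 : Tendsto (fun k => ∑ i, ∑ j, (M ^ k) i j ^ 2) atTop (𝓝 0) := by
    have := tendsto_finsetSum (Finset.univ : Finset ι) fun i _ =>
      tendsto_finsetSum (Finset.univ : Finset ι) fun j _ =>
        (M.tendsto_pow_zero_of_spectrum_lt_one h i j).pow 2
    simpa using this
  obtain ⟨N, hN⟩ := (h1.eventually_lt_const (show (0 : ℝ) < 1 / 2 by norm_num)).exists
  exact ⟨N, fun z => (mulVec_dotProduct_self_le _ z).trans
    (mul_le_mul_of_nonneg_right hN.le (dotProduct_self_nonneg_real z))⟩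

/-- A stable matrix admits a strict Lyapunov function of arbitrarily large decrease. -/
theorem exists_lyapunov [Nonempty ι] (M : Matrix ι ι ℝ)
    (h : ∀ z ∈ spectrum ℂ (M.map (algebraMap ℝ ℂ)), ‖z‖ < 1) {w : ℝ} (hw : 0 ≤ w) :
    ∃ P : Matrix ι ι ℝ, P.PosSemidef ∧
      ∀ z, w * (z ⬝ᵥ z) + quadVal P (M *ᵥ z) ≤ quadVal P z := by
  obtain ⟨N, hN⟩ := exists_pow_contraction M h
  -- Along `M` the sum telescopes to `|z|² - |M ^ N z|²`, which is at least half of `|z|²`; the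
  -- factor 2 compensates for the half.
  set P : Matrix ι ι ℝ := (2 * w) • ∑ k ∈ Finset.range N, (M ^ k)ᵀ * (1 : Matrix ι ι ℝ) * M ^ k
  have hq : ∀ z, quadVal P z
      = 2 * w * ∑ k ∈ Finset.range N, ((M ^ k) *ᵥ z) ⬝ᵥ ((M ^ k) *ᵥ z) := fun z => by
    simp only [P, quadVal_smul, quadVal_sum, quadVal_transpose_mul_mul, quadVal_one]
  refine ⟨P, posSemidef_of_quadVal_nonneg ?_ fun z => ?_, fun z => ?_⟩
  · refine IsSymm.smul ?_ _
    simp [IsSymm, transpose_sum, transpose_mul]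
  · rw [hq]
    exact mul_nonneg (by positivity) (Finset.sum_nonneg fun k _ => dotProduct_self_nonneg_real _)
  · have htel : ∑ k ∈ Finset.range N, ((M ^ k) *ᵥ (M *ᵥ z)) ⬝ᵥ ((M ^ k) *ᵥ (M *ᵥ z)) + z ⬝ᵥ z
        = ∑ k ∈ Finset.range N, ((M ^ k) *ᵥ z) ⬝ᵥ ((M ^ k) *ᵥ z)
          + ((M ^ N) *ᵥ z) ⬝ᵥ ((M ^ N) *ᵥ z) := by
      rw [← Finset.sum_range_succ fun k => ((M ^ k) *ᵥ z) ⬝ᵥ ((M ^ k) *ᵥ z),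
        Finset.sum_range_succ']
      simp [mulVec_mulVec, pow_succ]
    rw [hq, hq]
    nlinarith [mul_le_mul_of_nonneg_left (hN z) hw]

end Lyapunov

/-! ### Stabilizability and Riccati supersolutions -/

namespace AffineLQ

variable {n m : ℕ} {S : AffineLQ n m}

/-- The gain ignores the added coordinate. The closed loop is block triangular, and its only new
eigenvalue is `√γ < 1`. -/
theorem exists_augmented_stabilizing (hγ₁ : S.γ < 1) (hstab : S.Stabilizable) :
    ∃ K : Matrix (Fin m) (Fin n ⊕ Unit) ℝ,
      ∀ z ∈ spectrum ℂ ((√S.γ • (S.augA + S.augB * K)).map (algebraMap ℝ ℂ)), ‖z‖ < 1 := by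
  obtain ⟨K, hK⟩ := hstab
  refine ⟨fromCols K 0, fun z hz => ?_⟩
  have h1 : (√S.γ • (S.augA + S.augB * fromCols K 0)).map (algebraMap ℝ ℂ)
      = fromBlocks ((√S.γ • S.A + (√S.γ • S.B) * K).map (algebraMap ℝ ℂ))
        ((√S.γ • replicateCol Unit (S.c + S.mean)).map (algebraMap ℝ ℂ)) 0
        (algebraMap ℂ (Matrix Unit Unit ℂ) (√S.γ : ℂ)) := by
    rw [augA, augB, fromRows_mul_fromCols, fromBlocks_add, fromBlocks_smul, fromBlocks_map]
    congr 1
    · simp [smul_add, Matrix.smul_mul]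
    · simp
    · ext i j; simp
    · ext i j; simp [Matrix.algebraMap_matrix_apply]
  rw [h1, mem_spectrum_iff_isRoot_charpoly, charpoly_fromBlocks_zero₂₁, Polynomial.root_mul,
    ← mem_spectrum_iff_isRoot_charpoly, ← mem_spectrum_iff_isRoot_charpoly,
    spectrum.scalar_eq] at hz
  rcases hz with hz | hz
  · exact hK z hz
  · rw [Set.mem_singleton_iff.1 hz, Complex.norm_real, Real.norm_of_nonneg (Real.sqrt_nonneg _)]
    exact (Real.sqrt_lt' one_pos).2 (by simpa using hγ₁)

/-- The Riccati operator has supersolutions that dominate any prescribed multiple of the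
identity. -/
theorem exists_riccati_le (hγ₀ : 0 < S.γ) (hγ₁ : S.γ < 1) (hstab : S.Stabilizable)
    (hLuu : S.Luu.PosDef) {C : ℝ} (hC : 0 ≤ C) :
    ∃ U : Matrix (Fin n ⊕ Unit) (Fin n ⊕ Unit) ℝ, U.PosSemidef ∧
      (∀ z, C * (z ⬝ᵥ z) ≤ quadVal U z) ∧ ∀ z, quadVal (S.riccati U) z ≤ quadVal U z := by
  obtain ⟨K, hK⟩ := exists_augmented_stabilizing hγ₁ hstab
  set W := S.augLxx + (2 : ℝ) • (S.augLxu * K) + Kᵀ * S.Luu * K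
  have hW : ∀ z, S.augCost z (K *ᵥ z) = quadVal W z := fun z => by
    rw [quadVal_add, quadVal_add, quadVal_smul, quadVal_transpose_mul_mul, augCost, quadVal,
      quadVal, quadVal, ← mulVec_mulVec]
  obtain ⟨w, hw0, hw⟩ := exists_abs_dotProduct_mulVec_le W
  -- The closed-loop cost is at most `2 w |z|²`, which the decrease of `U` absorbs; the additional
  -- `C` forces `U` above `C` times the identity.
  obtain ⟨U, hU, hUz⟩ := exists_lyapunov _ hK (w := 2 * w + C) (by positivity)
  have hpos := fun z => hU.quadVal_nonneg z
  refine ⟨U, hU, fun z => ?_, fun z => ?_⟩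
  · have h1 := hUz z
    have h2 := mul_nonneg hw0 (dotProduct_self_nonneg_real z)
    have h3 := hpos ((√S.γ • (S.augA + S.augB * K)) *ᵥ z)
    linarith
  · refine (riccati_le_qForm hγ₀.le hLuu hU z (K *ᵥ z)).trans ?_
    have h1 := hUz z
    have h2 := mul_nonneg hC (dotProduct_self_nonneg_real z)
    have h3 := (abs_le.1 (hw z z)).2
    rw [smul_mulVec, quadVal_vecSmul, Real.sq_sqrt hγ₀.le, add_mulVec, ← mulVec_mulVec] at h1
    rw [qForm, hW, quadVal]
    linarith

end AffineLQ

/-! ### Discounted accumulation -/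

/-- The recursion `a₀ = a`, `aₖ₊₁ = γ (aₖ + tₖ)`. -/
def discIter (γ a : ℝ) (t : ℕ → ℝ) : ℕ → ℝ
  | 0 => a
  | k + 1 => γ * (discIter γ a t k + t k)

theorem discIter_nonneg {γ a : ℝ} {t : ℕ → ℝ} (hγ : 0 ≤ γ) (ha : 0 ≤ a) (ht : ∀ k, 0 ≤ t k) :
    ∀ k, 0 ≤ discIter γ a t k
  | 0 => ha
  | k + 1 => mul_nonneg hγ (add_nonneg (discIter_nonneg hγ ha ht k) (ht k))

/-- The recursion is a `γ`-contraction towards its limit with a vanishing perturbation. -/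
theorem tendsto_discIter {γ : ℝ} (a : ℝ) {t : ℕ → ℝ} {τ : ℝ} (hγ : 0 ≤ γ) (hγ₁ : γ < 1)
    (ht : Tendsto t atTop (𝓝 τ)) :
    Tendsto (discIter γ a t) atTop (𝓝 (γ * τ / (1 - γ))) := by
  have h1 : 0 < 1 - γ := by linarith
  set c := γ * τ / (1 - γ) with hc
  have hstep : ∀ k, discIter γ a t (k + 1) - c
      = γ * (discIter γ a t k - c) + γ * (t k - τ) := fun k => by
    rw [discIter, hc]; field_simp; ring
  rw [Metric.tendsto_atTop]
  intro ε hε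
  -- This tolerance makes `ε / 2` self-reproducing: `γ ε / 2 + (1 - γ) ε / 2 = ε / 2`.
  obtain ⟨N, hN⟩ := Metric.tendsto_atTop.1 ht (ε / 2 * (1 - γ)) (by positivity)
  set D := |discIter γ a t N - c|
  have hbound : ∀ k, |discIter γ a t (N + k) - c| ≤ γ ^ k * D + ε / 2 := by
    intro k
    induction k with
    | zero => simp only [add_zero, pow_zero, one_mul]; exact le_add_of_nonneg_right (by positivity)
    | succ k ih =>
      have h2 := (hN (N + k) (by omega)).le
      rw [Real.dist_eq] at h2
      rw [← add_assoc, hstep]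
      calc |γ * (discIter γ a t (N + k) - c) + γ * (t (N + k) - τ)|
          ≤ |γ * (discIter γ a t (N + k) - c)| + |γ * (t (N + k) - τ)| := abs_add_le _ _
        _ = γ * |discIter γ a t (N + k) - c| + γ * |t (N + k) - τ| := by
            rw [abs_mul, abs_mul, abs_of_nonneg hγ]
        _ ≤ γ * (γ ^ k * D + ε / 2) + 1 * (ε / 2 * (1 - γ)) := by gcongr
        _ = γ ^ (k + 1) * D + ε / 2 := by ring
  have hlim : Tendsto (fun k => γ ^ k * D) atTop (𝓝 0) := by
    simpa using (tendsto_pow_atTop_nhds_zero_of_lt_one hγ hγ₁).mul_const D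
  obtain ⟨k₀, hk₀⟩ := eventually_atTop.1 (hlim.eventually_lt_const (half_pos hε))
  refine ⟨N + k₀, fun k hk => ?_⟩
  obtain ⟨j, rfl⟩ := Nat.exists_eq_add_of_le (show N ≤ k by omega)
  rw [Real.dist_eq]
  have h3 := hk₀ j (by omega)
  have h4 := hbound j
  linarith

theorem tendsto_matrix_mul {ι κ σ : Type*} [Fintype κ] {X : ℕ → Matrix ι κ ℝ}
    {Y : ℕ → Matrix κ σ ℝ} {X₀ : Matrix ι κ ℝ} {Y₀ : Matrix κ σ ℝ} (hX : Tendsto X atTop (𝓝 X₀))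
    (hY : Tendsto Y atTop (𝓝 Y₀)) : Tendsto (fun k => X k * Y k) atTop (𝓝 (X₀ * Y₀)) :=
  ((continuous_fst.matrix_mul continuous_snd).tendsto (X₀, Y₀)).comp (hX.prodMk_nhds hY)

namespace AffineLQ

variable {n m : ℕ} {S : AffineLQ n m} {P Q : Matrix (Fin n ⊕ Unit) (Fin n ⊕ Unit) ℝ}

/-! ### Riccati iteration -/

theorem tendsto_augQ {X : ℕ → Matrix (Fin n ⊕ Unit) (Fin n ⊕ Unit) ℝ}
    (h : Tendsto X atTop (𝓝 Q)) : Tendsto (fun k => S.augQ (X k)) atTop (𝓝 (S.augQ Q)) := by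
  have hc : Continuous S.augQ := by unfold augQ; fun_prop
  exact (hc.tendsto Q).comp h

/-- Continuity is needed only at a semidefinite limit, where `qc` is positive definite and inversion
is continuous. -/
theorem tendsto_riccati (hγ : 0 ≤ S.γ) (hLuu : S.Luu.PosDef) (hQ : Q.PosSemidef)
    {X : ℕ → Matrix (Fin n ⊕ Unit) (Fin n ⊕ Unit) ℝ} (h : Tendsto X atTop (𝓝 Q)) :
    Tendsto (fun k => S.riccati (X k)) atTop (𝓝 (S.riccati Q)) := by
  have hl : Continuous S.augQl := by unfold augQl; fun_prop
  have hc : Continuous S.qc := by unfold qc; fun_prop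
  have h1 := tendsto_matrix_inv (qc_posDef hγ hLuu hQ).isUnit ((hc.tendsto Q).comp h)
  have h2 := (hl.tendsto Q).comp h
  have h3 : Tendsto (fun k => (S.augQl (X k))ᵀ) atTop (𝓝 (S.augQl Q)ᵀ) :=
    (hl.matrix_transpose.tendsto Q).comp h
  exact (tendsto_augQ h).sub (tendsto_matrix_mul (tendsto_matrix_mul h2 h1) h3)

/-- Riccati iteration from `P`. -/
def riccatiIter (S : AffineLQ n m) (P : Matrix (Fin n ⊕ Unit) (Fin n ⊕ Unit) ℝ) (k : ℕ) :
    Matrix (Fin n ⊕ Unit) (Fin n ⊕ Unit) ℝ := S.riccati^[k] P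

theorem riccatiIter_succ (k : ℕ) : S.riccatiIter P (k + 1) = S.riccati (S.riccatiIter P k) :=
  Function.iterate_succ_apply' _ _ _

theorem riccatiIter_posSemidef (hγ : 0 ≤ S.γ) (hLxx : S.Lxx.IsSymm) (hLuu : S.Luu.PosDef)
    (hcost : ∀ x u, 0 ≤ S.cost x u) (hP : P.PosSemidef) (k : ℕ) :
    (S.riccatiIter P k).PosSemidef := by
  induction k with
  | zero => exact hP
  | succ k ih =>
    rw [riccatiIter_succ]
    exact riccati_posSemidef hγ hLxx hLuu hcost ih

theorem isRiccatiSolution_of_tendsto (hγ : 0 ≤ S.γ) (hLxx : S.Lxx.IsSymm) (hLuu : S.Luu.PosDef)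
    (hcost : ∀ x u, 0 ≤ S.cost x u) (hP : P.PosSemidef)
    (h : Tendsto (S.riccatiIter P) atTop (𝓝 Q)) : S.IsRiccatiSolution Q := by
  have hQ := posSemidef_of_tendsto (riccatiIter_posSemidef hγ hLxx hLuu hcost hP) h
  refine isRiccatiSolution_iff.2 ⟨hQ, ?_⟩
  have h1 := (tendsto_add_atTop_iff_nat 1).2 h
  simp_rw [riccatiIter_succ] at h1
  exact tendsto_nhds_unique (tendsto_riccati hγ hLuu hQ h) h1

/-- Every positive semidefinite supersolution, in particular every Riccati solution, bounds the
iteration from `0`; this gives both convergence and leastness. -/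
theorem riccatiIter_zero_le (hγ : 0 ≤ S.γ) (hLxx : S.Lxx.IsSymm) (hLuu : S.Luu.PosDef)
    (hcost : ∀ x u, 0 ≤ S.cost x u) (hP : P.PosSemidef)
    (hsuper : ∀ z, quadVal (S.riccati P) z ≤ quadVal P z) (k : ℕ) (z : Fin n ⊕ Unit → ℝ) :
    quadVal (S.riccatiIter 0 k) z ≤ quadVal P z := by
  induction k generalizing z with
  | zero =>
    have : quadVal (S.riccatiIter 0 0) z = 0 := by simp [riccatiIter, quadVal]
    rw [this]
    exact hP.quadVal_nonneg z
  | succ k ih =>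
    rw [riccatiIter_succ]
    exact (riccati_mono hγ hLuu (riccatiIter_posSemidef hγ hLxx hLuu hcost .zero k) hP ih z).trans
      (hsuper z)

/-- Riccati iteration from `0` converges to the least Riccati solution. -/
theorem exists_least_riccati (hγ₀ : 0 < S.γ) (hγ₁ : S.γ < 1) (hstab : S.Stabilizable)
    (hLxx : S.Lxx.IsSymm) (hLuu : S.Luu.PosDef) (hcost : ∀ x u, 0 ≤ S.cost x u) :
    ∃ Q, Tendsto (S.riccatiIter 0) atTop (𝓝 Q) ∧ S.IsRiccatiSolution Q ∧
      ∀ P', S.IsRiccatiSolution P' → (P' - Q).PosSemidef := by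
  have hps := riccatiIter_posSemidef hγ₀.le hLxx hLuu hcost (P := 0) .zero
  obtain ⟨U, hU, -, hUr⟩ := exists_riccati_le hγ₀ hγ₁ hstab hLuu le_rfl
  have hmono : ∀ k z, quadVal (S.riccatiIter 0 k) z ≤ quadVal (S.riccatiIter 0 (k + 1)) z := by
    intro k
    induction k with
    | zero =>
      intro z
      have : quadVal (S.riccatiIter 0 0) z = 0 := by simp [riccatiIter, quadVal]
      rw [this]
      exact (hps 1).quadVal_nonneg z
    | succ k ih =>
      intro z
      have := riccati_mono hγ₀.le hLuu (hps k) (hps (k + 1)) ih z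
      rwa [← riccatiIter_succ, ← riccatiIter_succ] at this
  obtain ⟨Q, hQ⟩ := exists_tendsto_of_monotone (fun k => (hps k).isSymm) hmono
    (riccatiIter_zero_le hγ₀.le hLxx hLuu hcost hU hUr)
  have hsol := isRiccatiSolution_of_tendsto hγ₀.le hLxx hLuu hcost .zero hQ
  refine ⟨Q, hQ, hsol, fun P' hP' => ?_⟩
  obtain ⟨hP1, hP2⟩ := isRiccatiSolution_iff.1 hP'
  refine posSemidef_of_quadVal_nonneg (hP1.isSymm.sub hsol.1.isSymm) fun z => ?_
  rw [quadVal_sub, sub_nonneg]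
  exact le_of_tendsto' (((continuous_quadVal z).tendsto Q).comp hQ) fun k =>
    riccatiIter_zero_le hγ₀.le hLxx hLuu hcost hP1 (fun z => by rw [hP2]) k z

/-- Riccati iteration from a supersolution converges to a Riccati solution. -/
theorem exists_tendsto_riccatiIter (hγ : 0 ≤ S.γ) (hLxx : S.Lxx.IsSymm) (hLuu : S.Luu.PosDef)
    (hcost : ∀ x u, 0 ≤ S.cost x u) (hP : P.PosSemidef)
    (hsuper : ∀ z, quadVal (S.riccati P) z ≤ quadVal P z) :
    ∃ Q, Tendsto (S.riccatiIter P) atTop (𝓝 Q) ∧ S.IsRiccatiSolution Q := by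
  have hps := riccatiIter_posSemidef hγ hLxx hLuu hcost hP
  have hanti : ∀ k z, quadVal (S.riccatiIter P (k + 1)) z ≤ quadVal (S.riccatiIter P k) z := by
    intro k
    induction k with
    | zero => exact hsuper
    | succ k ih =>
      intro z
      have := riccati_mono hγ hLuu (hps (k + 1)) (hps k) ih z
      rwa [← riccatiIter_succ, ← riccatiIter_succ] at this
  obtain ⟨Q, hQ⟩ := exists_tendsto_of_antitone (fun k => (hps k).isSymm) hanti
    (fun k => (hps k).quadVal_nonneg)
  exact ⟨Q, hQ, isRiccatiSolution_of_tendsto hγ hLxx hLuu hcost hP hQ⟩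

theorem tendsto_trace_toBlocks {X : ℕ → Matrix (Fin n ⊕ Unit) (Fin n ⊕ Unit) ℝ}
    (h : Tendsto X atTop (𝓝 Q)) :
    Tendsto (fun k => ((X k).toBlocks₁₁ * S.cov).trace) atTop
      (𝓝 (Q.toBlocks₁₁ * S.cov).trace) := by
  have hc : Continuous fun P : Matrix (Fin n ⊕ Unit) (Fin n ⊕ Unit) ℝ =>
      (P.toBlocks₁₁ * S.cov).trace :=
    ((continuous_id.matrix_submatrix Sum.inl Sum.inl).matrix_mul continuous_const).matrix_trace
  exact (hc.tendsto Q).comp h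

theorem tendsto_qForm_add {X : ℕ → Matrix (Fin n ⊕ Unit) (Fin n ⊕ Unit) ℝ} {a : ℕ → ℝ} {α : ℝ}
    (h : Tendsto X atTop (𝓝 Q)) (ha : Tendsto a atTop (𝓝 α)) (z : Fin n ⊕ Unit → ℝ)
    (u : Fin m → ℝ) :
    Tendsto (fun k => S.qForm (X k) z u + a k) atTop (𝓝 (S.qForm Q z u + α)) :=
  (((((continuous_quadVal _).tendsto Q).comp h).const_mul S.γ).const_add _).add ha

theorem qForm_zero (hLxx : S.Lxx.IsSymm) (x : Fin n → ℝ) (u : Fin m → ℝ) :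
    S.qForm 0 (aug x) u = S.cost x u := by
  simp [qForm, augCost_aug hLxx, quadVal]

/-! ### Limits of the value iteration bounds -/

section Noise

variable [IsProbabilityMeasure S.noise]

theorem bellman_lower_bound (hγ : 0 ≤ S.γ) (hγ₁ : S.γ < 1) (hLxx : S.Lxx.IsSymm)
    (hLuu : S.Luu.PosDef) (hcost : ∀ x u, 0 ≤ S.cost x u)
    (hnoise : ∀ i, MemLp (fun ξ : Fin n → ℝ => ξ i) 2 S.noise)
    {q : (Fin n → ℝ) → (Fin m → ℝ) → ℝ} (hq : S.IsBellmanFixedPoint q)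
    {a : ℝ} (hP : P.PosSemidef) (h : ∀ x u, S.qForm P (aug x) u + a ≤ q x u)
    (hQ : Tendsto (S.riccatiIter P) atTop (𝓝 Q)) (x : Fin n → ℝ) (u : Fin m → ℝ) :
    S.qForm Q (aug x) u + S.γ * (Q.toBlocks₁₁ * S.cov).trace / (1 - S.γ) ≤ q x u := by
  -- The shift to `k + 1` reflects that `F` minimizes first: the trace sees the new Riccati iterate.
  set t : ℕ → ℝ := fun k => ((S.riccatiIter P (k + 1)).toBlocks₁₁ * S.cov).trace
  have hb : ∀ k x u, S.qForm (S.riccatiIter P k) (aug x) u + discIter S.γ a t k ≤ q x u := by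
    intro k
    induction k with
    | zero => exact h
    | succ k ih =>
      intro x u
      have := bellman_lower_step hγ hLxx hLuu hnoise hq
        (riccatiIter_posSemidef hγ hLxx hLuu hcost hP k) ih x u
      rw [← riccatiIter_succ] at this
      exact this
  have ht := tendsto_discIter a hγ hγ₁
    (tendsto_trace_toBlocks (S := S) ((tendsto_add_atTop_iff_nat 1).2 hQ))
  exact le_of_tendsto' (tendsto_qForm_add hQ ht (aug x) u) fun k => hb k x u

theorem bellman_upper_bound (hγ : 0 ≤ S.γ) (hγ₁ : S.γ < 1) (hLxx : S.Lxx.IsSymm)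
    (hLuu : S.Luu.PosDef) (hcost : ∀ x u, 0 ≤ S.cost x u)
    (hnoise : ∀ i, MemLp (fun ξ : Fin n → ℝ => ξ i) 2 S.noise)
    {q : (Fin n → ℝ) → (Fin m → ℝ) → ℝ} (hq : S.IsBellmanFixedPoint q)
    {a : ℝ} (hP : P.PosSemidef) (h : ∀ x u, q x u ≤ S.qForm P (aug x) u + a)
    (hQ : Tendsto (S.riccatiIter P) atTop (𝓝 Q)) (x : Fin n → ℝ) (u : Fin m → ℝ) :
    q x u ≤ S.qForm Q (aug x) u + S.γ * (Q.toBlocks₁₁ * S.cov).trace / (1 - S.γ) := by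
  set t : ℕ → ℝ := fun k => ((S.riccatiIter P (k + 1)).toBlocks₁₁ * S.cov).trace
  have hb : ∀ k x u, q x u ≤ S.qForm (S.riccatiIter P k) (aug x) u + discIter S.γ a t k := by
    intro k
    induction k with
    | zero => exact h
    | succ k ih =>
      intro x u
      have := bellman_upper_step hγ hLxx hLuu hnoise hq
        (riccatiIter_posSemidef hγ hLxx hLuu hcost hP k) ih x u
      rw [← riccatiIter_succ] at this
      exact this
  have ht := tendsto_discIter a hγ hγ₁
    (tendsto_trace_toBlocks (S := S) ((tendsto_add_atTop_iff_nat 1).2 hQ))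
  exact ge_of_tendsto' (tendsto_qForm_add hQ ht (aug x) u) fun k => hb k x u

theorem relaxed_lower_bound (hγ : 0 ≤ S.γ) (hγ₁ : S.γ < 1) (hLxx : S.Lxx.IsSymm)
    (hLuu : S.Luu.PosDef) (hcost : ∀ x u, 0 ≤ S.cost x u)
    (hnoise : ∀ i, MemLp (fun ξ : Fin n → ℝ => ξ i) 2 S.noise)
    {q : (Fin n → ℝ) → (Fin m → ℝ) → ℝ} (hq : S.IsRelaxedFixedPoint q)
    {a : ℝ} (hP : P.PosSemidef) (h : ∀ x u, S.qForm P (aug x) u + a ≤ q x u)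
    (hQ : Tendsto (S.riccatiIter P) atTop (𝓝 Q)) (x : Fin n → ℝ) (u : Fin m → ℝ) :
    S.qForm Q (aug x) u + S.γ * ((S.augQ Q).toBlocks₁₁ * S.cov).trace / (1 - S.γ) ≤ q x u := by
  -- No shift here: `F̂` averages first, so the trace sees `augQ` of the current iterate.
  set t : ℕ → ℝ := fun k => ((S.augQ (S.riccatiIter P k)).toBlocks₁₁ * S.cov).trace
  have hb : ∀ k x u, S.qForm (S.riccatiIter P k) (aug x) u + discIter S.γ a t k ≤ q x u := by
    intro k
    induction k with
    | zero => exact h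
    | succ k ih =>
      intro x u
      have := relaxed_lower_step hγ hLxx hLuu hnoise hq
        (riccatiIter_posSemidef hγ hLxx hLuu hcost hP k) ih x u
      rw [← riccatiIter_succ] at this
      exact this
  have ht := tendsto_discIter a hγ hγ₁ (tendsto_trace_toBlocks (S := S) (tendsto_augQ (S := S) hQ))
  exact le_of_tendsto' (tendsto_qForm_add hQ ht (aug x) u) fun k => hb k x u

theorem relaxed_upper_bound (hγ : 0 ≤ S.γ) (hγ₁ : S.γ < 1) (hLxx : S.Lxx.IsSymm)
    (hLuu : S.Luu.PosDef) (hcost : ∀ x u, 0 ≤ S.cost x u)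
    (hnoise : ∀ i, MemLp (fun ξ : Fin n → ℝ => ξ i) 2 S.noise)
    {q : (Fin n → ℝ) → (Fin m → ℝ) → ℝ} (hq : S.IsRelaxedFixedPoint q)
    {a : ℝ} (hP : P.PosSemidef) (h : ∀ x u, q x u ≤ S.qForm P (aug x) u + a)
    (hQ : Tendsto (S.riccatiIter P) atTop (𝓝 Q)) (x : Fin n → ℝ) (u : Fin m → ℝ) :
    q x u ≤ S.qForm Q (aug x) u + S.γ * ((S.augQ Q).toBlocks₁₁ * S.cov).trace / (1 - S.γ) := by
  set t : ℕ → ℝ := fun k => ((S.augQ (S.riccatiIter P k)).toBlocks₁₁ * S.cov).trace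
  have hb : ∀ k x u, q x u ≤ S.qForm (S.riccatiIter P k) (aug x) u + discIter S.γ a t k := by
    intro k
    induction k with
    | zero => exact h
    | succ k ih =>
      intro x u
      have := relaxed_upper_step hγ hLxx hLuu hnoise hq
        (riccatiIter_posSemidef hγ hLxx hLuu hcost hP k) ih x u
      rw [← riccatiIter_succ] at this
      exact this
  have ht := tendsto_discIter a hγ hγ₁ (tendsto_trace_toBlocks (S := S) (tendsto_augQ (S := S) hQ))
  exact ge_of_tendsto' (tendsto_qForm_add hQ ht (aug x) u) fun k => hb k x u

/-- A Bellman fixed point of quadratic growth lies below one given by a supersolution. -/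
theorem bellman_initial_upper (hγ : 0 ≤ S.γ) (hLxx : S.Lxx.IsSymm)
    (hnoise : ∀ i, MemLp (fun ξ : Fin n → ℝ => ξ i) 2 S.noise)
    {q : (Fin n → ℝ) → (Fin m → ℝ) → ℝ} (hq : S.IsBellmanFixedPoint q) {C : ℝ}
    (hC : ∀ x u, |q x u| ≤ C * (1 + x ⬝ᵥ x + u ⬝ᵥ u)) (hP : P.PosSemidef)
    (hCP : ∀ z, C * (z ⬝ᵥ z) ≤ quadVal P z) (x : Fin n → ℝ) (u : Fin m → ℝ) :
    q x u ≤ S.qForm P (aug x) u + S.γ * (0 + (P.toBlocks₁₁ * S.cov).trace) := by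
  obtain ⟨h1, h2⟩ := cost_add_integral_quadVal hLxx hnoise hP.isSymm 0 x u
  rw [← h2, ← hq.2.2 x u, bellman]
  gcongr
  · exact hq.2.1 x u
  · intro ξ
    -- Choosing the next control 0 leaves the growth bound `C (1 + |x|²)`, which is `C` times the
    -- squared norm of `aug x`. The current control enters only through the stage cost and the
    -- dynamics, hence through `qForm`.
    refine (ciInf_le (hq.1 _) 0).trans ?_
    have h3 := (abs_le.1 (hC (S.dyn x u ξ) 0)).2
    have h4 := hCP (aug (S.dyn x u ξ))
    rw [aug_dotProduct_self] at h4
    simp only [dotProduct_zero, add_zero] at h3 ⊢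
    exact h3.trans h4

theorem relaxed_initial_upper (hγ : 0 ≤ S.γ) (hLxx : S.Lxx.IsSymm)
    (hnoise : ∀ i, MemLp (fun ξ : Fin n → ℝ => ξ i) 2 S.noise)
    {q : (Fin n → ℝ) → (Fin m → ℝ) → ℝ} (hq : S.IsRelaxedFixedPoint q) {C : ℝ}
    (hC : ∀ x u, |q x u| ≤ C * (1 + x ⬝ᵥ x + u ⬝ᵥ u)) (hP : P.PosSemidef)
    (hCP : ∀ z, C * (z ⬝ᵥ z) ≤ quadVal P z) (x : Fin n → ℝ) (u : Fin m → ℝ) :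
    q x u ≤ S.qForm P (aug x) u + S.γ * (0 + (P.toBlocks₁₁ * S.cov).trace) := by
  obtain ⟨h1, h2⟩ := cost_add_integral_quadVal hLxx hnoise hP.isSymm 0 x u
  rw [← h2, ← hq.2.2 x u, relaxedBellman]
  gcongr
  refine (ciInf_le (hq.2.1 x u) 0).trans (integral_mono (hq.1 x u 0) h1 fun ξ => ?_)
  have h3 := (abs_le.1 (hC (S.dyn x u ξ) 0)).2
  have h4 := hCP (aug (S.dyn x u ξ))
  rw [aug_dotProduct_self] at h4
  simp only [dotProduct_zero, add_zero] at h3 ⊢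
  exact h3.trans h4

end Noise

end AffineLQ

/-! ### Splitting off the first coordinate of an i.i.d. sequence -/

/-- The sequence with first term `ξ` followed by `ω`. -/
def consSeq {X : Type*} (ξ : X) (ω : ℕ → X) : ℕ → X
  | 0 => ξ
  | k + 1 => ω k

section ConsSeq

variable {X : Type*} [MeasurableSpace X]

theorem measurable_consSeq : Measurable fun p : X × (ℕ → X) => consSeq p.1 p.2 := by
  refine measurable_pi_lambda _ fun k => ?_
  cases k with
  | zero => exact measurable_fst
  | succ k => exact (measurable_pi_apply k).comp measurable_snd

/-- Prepending an independent draw preserves the i.i.d. law; it is enough to compare measures of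
finite cylinders. -/
theorem map_consSeq_prod_infinitePi (μ : Measure X) [IsProbabilityMeasure μ] :
    (μ.prod (Measure.infinitePi fun _ : ℕ => μ)).map (fun p => consSeq p.1 p.2)
      = Measure.infinitePi fun _ : ℕ => μ := by
  classical
  refine Measure.eq_infinitePi _ fun s t ht => ?_
  obtain ⟨N, hN⟩ := s.exists_nat_subset_range
  -- Padding with `Set.univ` makes the cylinder depend on an initial segment, so its preimage splits
  -- as a product of first coordinate and tail.
  set t' : ℕ → Set X := fun i => if i ∈ s then t i else Set.univ with ht'
  have ht'm : ∀ i, MeasurableSet (t' i) := fun i => by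
    by_cases hi : i ∈ s
    · simpa [ht', hi] using ht i
    · simp [ht', hi]
  have hsub : s ⊆ Finset.range (N + 1) := hN.trans (Finset.range_mono (Nat.le_succ N))
  have hset : Set.pi (s : Set ℕ) t = Set.pi (Finset.range (N + 1) : Set ℕ) t' := by
    ext ω
    simp only [Set.mem_pi, Finset.mem_coe]
    constructor
    · intro h i _
      by_cases hi : i ∈ s
      · simpa [ht', hi] using h i hi
      · simp [ht', hi]
    · intro h i hi
      simpa [ht', hi] using h i (hsub hi)
  have hprod : ∏ i ∈ s, μ (t i) = ∏ i ∈ Finset.range (N + 1), μ (t' i) := by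
    rw [← Finset.prod_subset hsub fun i _ hi => by simp [ht', hi]]
    exact Finset.prod_congr rfl fun i hi => by simp [ht', hi]
  have hpre : (fun p : X × (ℕ → X) => consSeq p.1 p.2) ⁻¹'
      Set.pi (Finset.range (N + 1) : Set ℕ) t'
        = t' 0 ×ˢ Set.pi (Finset.range N : Set ℕ) fun i => t' (i + 1) := by
    ext ⟨ξ, ω⟩
    simp only [Set.mem_preimage, Set.mem_pi, Finset.mem_coe, Finset.mem_range, Set.mem_prod]
    constructor
    · exact fun h => ⟨h 0 (Nat.succ_pos _), fun i hi => h (i + 1) (Nat.succ_lt_succ hi)⟩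
    · rintro ⟨h0, h1⟩ (_ | i) hi
      · exact h0
      · exact h1 i (Nat.lt_of_succ_lt_succ hi)
  rw [hset, hprod, Measure.map_apply measurable_consSeq
    (MeasurableSet.pi (Finset.countable_toSet _) fun i _ => ht'm i), hpre, Measure.prod_prod,
    Measure.infinitePi_pi _ fun i _ => ht'm (i + 1), Finset.prod_range_succ', mul_comm]

theorem lintegral_infinitePi_consSeq (μ : Measure X) [IsProbabilityMeasure μ]
    {f : (ℕ → X) → ENNReal} (hf : Measurable f) :
    ∫⁻ ω, f ω ∂(Measure.infinitePi fun _ : ℕ => μ)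
      = ∫⁻ ξ, ∫⁻ ω, f (consSeq ξ ω) ∂(Measure.infinitePi fun _ : ℕ => μ) ∂μ := by
  conv_lhs => rw [← map_consSeq_prod_infinitePi μ]
  have hm : Measurable fun p : X × (ℕ → X) => f (consSeq p.1 p.2) := hf.comp measurable_consSeq
  rw [lintegral_map hf measurable_consSeq, lintegral_prod _ hm.aemeasurable]

end ConsSeq

namespace AffineLQ

variable {n m : ℕ} {S : AffineLQ n m} {P Q : Matrix (Fin n ⊕ Unit) (Fin n ⊕ Unit) ℝ}
  {π : (Fin n → ℝ) → (Fin m → ℝ)}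

/-! ### Cost of a stationary policy -/

theorem traj_consSeq (x ξ : Fin n → ℝ) (ω : ℕ → Fin n → ℝ) (k : ℕ) :
    S.traj π x (consSeq ξ ω) (k + 1) = S.traj π (S.dyn x (π x) ξ) ω k := by
  induction k with
  | zero => rfl
  | succ k ih => rw [traj, ih]; rfl

theorem measurable_dyn_policy {α : Type*} [MeasurableSpace α] (hπ : Measurable π)
    {f g : α → Fin n → ℝ} (hf : Measurable f) (hg : Measurable g) :
    Measurable fun a => S.dyn (f a) (π (f a)) (g a) := by
  have hA : Measurable fun x : Fin n → ℝ => S.A *ᵥ x :=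
    (continuous_const.matrix_mulVec continuous_id).measurable
  have hB : Measurable fun u : Fin m → ℝ => S.B *ᵥ u :=
    (continuous_const.matrix_mulVec continuous_id).measurable
  have hBπ : Measurable fun a => S.B *ᵥ π (f a) := hB.comp (hπ.comp hf)
  have hAf : Measurable fun a => S.A *ᵥ f a := hA.comp hf
  exact ((hAf.add hBπ).add_const S.c).add hg

theorem measurable_traj {α : Type*} [MeasurableSpace α] (hπ : Measurable π) {f : α → Fin n → ℝ}
    {g : α → ℕ → Fin n → ℝ} (hf : Measurable f) (hg : Measurable g) (k : ℕ) :
    Measurable fun a => S.traj π (f a) (g a) k := by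
  induction k with
  | zero => exact hf
  | succ k ih =>
    have hk : Measurable fun a => g a k := (measurable_pi_apply k).comp hg
    exact measurable_dyn_policy hπ ih hk

theorem measurable_cost_policy (hLxx : S.Lxx.IsSymm) (hπ : Measurable π) :
    Measurable fun x => S.cost x (π x) := by
  have h := (continuous_qForm (S := S) (P := 0)).measurable.comp (measurable_id.prodMk hπ)
  simpa [Function.comp_def, qForm_zero hLxx] using h

theorem measurable_stageCost_integrand {α : Type*} [MeasurableSpace α] (hLxx : S.Lxx.IsSymm)
    (hπ : Measurable π) {f : α → Fin n → ℝ} {g : α → ℕ → Fin n → ℝ} (hf : Measurable f)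
    (hg : Measurable g) (k : ℕ) :
    Measurable fun a =>
      ENNReal.ofReal (S.γ ^ k * S.cost (S.traj π (f a) (g a) k) (π (S.traj π (f a) (g a) k))) :=
  (((measurable_cost_policy hLxx hπ).comp (measurable_traj hπ hf hg k)).const_mul _).ennreal_ofReal

section Noise

variable [IsProbabilityMeasure S.noise]

/-- Expected discounted cost incurred at time `k`. -/
def stageCost (S : AffineLQ n m) [IsProbabilityMeasure S.noise] (π : (Fin n → ℝ) → (Fin m → ℝ))
    (k : ℕ) (x : Fin n → ℝ) : ENNReal :=
  ∫⁻ ω, ENNReal.ofReal (S.γ ^ k * S.cost (S.traj π x ω k) (π (S.traj π x ω k)))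
    ∂(Measure.infinitePi fun _ : ℕ => S.noise)

theorem measurable_stageCost (hLxx : S.Lxx.IsSymm) (hπ : Measurable π) (k : ℕ) :
    Measurable (S.stageCost π k) :=
  (measurable_stageCost_integrand hLxx hπ measurable_fst measurable_snd k).lintegral_prod_right'

theorem policyCost_eq_tsum (hLxx : S.Lxx.IsSymm) (hπ : Measurable π) (x : Fin n → ℝ) :
    S.policyCost π x = ∑' k, S.stageCost π k x :=
  lintegral_tsum fun k =>
    (measurable_stageCost_integrand hLxx hπ measurable_const measurable_id k).aemeasurable

theorem stageCost_zero (x : Fin n → ℝ) :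
    S.stageCost π 0 x = ENNReal.ofReal (S.cost x (π x)) := by
  simp [stageCost, traj]

/-- The Markov property at the first step: conditioned on the first noise term, the remaining path
is a fresh trajectory from the successor state. -/
theorem stageCost_succ (hγ : 0 ≤ S.γ) (hLxx : S.Lxx.IsSymm) (hπ : Measurable π) (k : ℕ)
    (x : Fin n → ℝ) :
    S.stageCost π (k + 1) x
      = ENNReal.ofReal S.γ * ∫⁻ ξ, S.stageCost π k (S.dyn x (π x) ξ) ∂S.noise := by
  have hd : Measurable fun ξ => S.dyn x (π x) ξ :=
    measurable_dyn_policy hπ measurable_const measurable_id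
  have hg : Measurable fun ξ => S.stageCost π k (S.dyn x (π x) ξ) :=
    (measurable_stageCost hLxx hπ k).comp hd
  have hpt : ∀ ξ ω, ENNReal.ofReal (S.γ ^ (k + 1) * S.cost (S.traj π x (consSeq ξ ω) (k + 1))
        (π (S.traj π x (consSeq ξ ω) (k + 1))))
      = ENNReal.ofReal S.γ * ENNReal.ofReal (S.γ ^ k * S.cost
        (S.traj π (S.dyn x (π x) ξ) ω k) (π (S.traj π (S.dyn x (π x) ξ) ω k))) := by
    intro ξ ω
    rw [traj_consSeq, ← ENNReal.ofReal_mul hγ, pow_succ', mul_assoc]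
  calc S.stageCost π (k + 1) x
      = ∫⁻ ξ, ∫⁻ ω, ENNReal.ofReal (S.γ ^ (k + 1)
          * S.cost (S.traj π x (consSeq ξ ω) (k + 1)) (π (S.traj π x (consSeq ξ ω) (k + 1))))
          ∂(Measure.infinitePi fun _ : ℕ => S.noise) ∂S.noise :=
        lintegral_infinitePi_consSeq S.noise (measurable_stageCost_integrand hLxx hπ measurable_const measurable_id _)
    _ = ∫⁻ ξ, ENNReal.ofReal S.γ * S.stageCost π k (S.dyn x (π x) ξ) ∂S.noise := by
        refine lintegral_congr fun ξ => ?_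
        simp_rw [hpt]
        exact lintegral_const_mul _
          (measurable_stageCost_integrand hLxx hπ measurable_const measurable_id k)
    _ = _ := lintegral_const_mul _ hg

theorem sum_stageCost_succ (hγ : 0 ≤ S.γ) (hLxx : S.Lxx.IsSymm) (hπ : Measurable π) (N : ℕ)
    (x : Fin n → ℝ) :
    ∑ k ∈ Finset.range (N + 1), S.stageCost π k x = ENNReal.ofReal (S.cost x (π x))
      + ENNReal.ofReal S.γ
        * ∫⁻ ξ, ∑ k ∈ Finset.range N, S.stageCost π k (S.dyn x (π x) ξ) ∂S.noise := by
  have hd : Measurable fun ξ => S.dyn x (π x) ξ :=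
    measurable_dyn_policy hπ measurable_const measurable_id
  have hg : ∀ k, Measurable fun ξ => S.stageCost π k (S.dyn x (π x) ξ) := fun k =>
    (measurable_stageCost hLxx hπ k).comp hd
  rw [Finset.sum_range_succ', stageCost_zero, add_comm,
    lintegral_finsetSum _ fun k _ => hg k, Finset.mul_sum]
  simp_rw [stageCost_succ hγ hLxx hπ]

theorem ofReal_cost_add_lintegral (hγ : 0 ≤ S.γ) (hLxx : S.Lxx.IsSymm)
    (hcost : ∀ x u, 0 ≤ S.cost x u)
    (hnoise : ∀ i, MemLp (fun ξ : Fin n → ℝ => ξ i) 2 S.noise) (hP : P.PosSemidef) {a : ℝ}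
    (ha : 0 ≤ a) (x : Fin n → ℝ) (u : Fin m → ℝ) :
    ENNReal.ofReal (S.cost x u) + ENNReal.ofReal S.γ
        * ∫⁻ ξ, ENNReal.ofReal (quadVal P (aug (S.dyn x u ξ)) + a) ∂S.noise
      = ENNReal.ofReal (S.qForm P (aug x) u + S.γ * (a + (P.toBlocks₁₁ * S.cov).trace)) := by
  obtain ⟨h1, h2⟩ := cost_add_integral_quadVal hLxx hnoise hP.isSymm a x u
  have hnn : ∀ ξ, 0 ≤ quadVal P (aug (S.dyn x u ξ)) + a :=
    fun ξ => add_nonneg (hP.quadVal_nonneg _) ha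
  rw [← ofReal_integral_eq_lintegral_ofReal h1 (.of_forall hnn), ← ENNReal.ofReal_mul hγ,
    ← ENNReal.ofReal_add (hcost x u) (mul_nonneg hγ (integral_nonneg hnn)), h2]

/-- The iterate from `0` gives the optimal `k`-stage value, a lower bound for the first `k` stage
costs of any policy. Nonnegative costs then allow passing to the limit. -/
theorem le_policyCost (hγ : 0 ≤ S.γ) (hγ₁ : S.γ < 1) (hLxx : S.Lxx.IsSymm)
    (hLuu : S.Luu.PosDef) (hcost : ∀ x u, 0 ≤ S.cost x u)
    (hnoise : ∀ i, MemLp (fun ξ : Fin n → ℝ => ξ i) 2 S.noise) (hπ : Measurable π)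
    (hQ : Tendsto (S.riccatiIter 0) atTop (𝓝 Q)) (x : Fin n → ℝ) :
    ENNReal.ofReal (quadVal Q (aug x) + S.γ * (Q.toBlocks₁₁ * S.cov).trace / (1 - S.γ))
      ≤ S.policyCost π x := by
  have hps := riccatiIter_posSemidef hγ hLxx hLuu hcost (P := 0) .zero
  -- The recursion is for value functions, not Q-functions, so the trace uses the current iterate
  -- without shift.
  set t : ℕ → ℝ := fun k => ((S.riccatiIter 0 k).toBlocks₁₁ * S.cov).trace
  have ha : ∀ k, 0 ≤ discIter S.γ 0 t k :=
    discIter_nonneg hγ le_rfl fun k => trace_toBlocks_mul_cov_nonneg hnoise (hps k)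
  have hb : ∀ k x, ENNReal.ofReal (quadVal (S.riccatiIter 0 k) (aug x) + discIter S.γ 0 t k)
      ≤ ∑ j ∈ Finset.range k, S.stageCost π j x := by
    intro k
    induction k with
    | zero => intro x; simp [riccatiIter, quadVal, discIter]
    | succ k ih =>
      intro x
      rw [sum_stageCost_succ hγ hLxx hπ]
      refine le_trans ?_ (add_le_add le_rfl
        (mul_le_mul_right (lintegral_mono fun ξ => ih (S.dyn x (π x) ξ)) _))
      rw [ofReal_cost_add_lintegral hγ hLxx hcost hnoise (hps k) (ha k), riccatiIter_succ]
      exact ENNReal.ofReal_le_ofReal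
        (add_le_add (riccati_le_qForm hγ hLuu (hps k) _ _) le_rfl)
  have ht := tendsto_discIter 0 hγ hγ₁ (tendsto_trace_toBlocks (S := S) hQ)
  have hlim := ENNReal.tendsto_ofReal
    ((((continuous_quadVal (aug x)).tendsto Q).comp hQ).add ht)
  refine le_of_tendsto' hlim fun k => (hb k x).trans ?_
  rw [policyCost_eq_tsum hLxx hπ]
  exact ENNReal.sum_le_tsum _

/-- Under its own feedback the value function reproduces itself. Starting the induction from zero
terminal cost discards a nonnegative term, so no decay of the terminal value is required. -/
theorem policyCost_policy_le (hγ : 0 ≤ S.γ) (hγ₁ : S.γ < 1) (hLxx : S.Lxx.IsSymm)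
    (hLuu : S.Luu.PosDef) (hcost : ∀ x u, 0 ≤ S.cost x u)
    (hnoise : ∀ i, MemLp (fun ξ : Fin n → ℝ => ξ i) 2 S.noise) (hP : P.PosSemidef)
    (hric : S.riccati P = P) (hπ : Measurable (S.policy P)) (x : Fin n → ℝ) :
    S.policyCost (S.policy P) x
      ≤ ENNReal.ofReal (quadVal P (aug x) + S.γ * (P.toBlocks₁₁ * S.cov).trace / (1 - S.γ)) := by
  have h1 : 0 < 1 - S.γ := by linarith
  set a := S.γ * (P.toBlocks₁₁ * S.cov).trace / (1 - S.γ) with ha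
  have ha0 : 0 ≤ a :=
    div_nonneg (mul_nonneg hγ (trace_toBlocks_mul_cov_nonneg hnoise hP)) h1.le
  have hfix : S.γ * (a + (P.toBlocks₁₁ * S.cov).trace) = a := by
    rw [ha]; field_simp; ring
  have hb : ∀ k x, ∑ j ∈ Finset.range k, S.stageCost (S.policy P) j x
      ≤ ENNReal.ofReal (quadVal P (aug x) + a) := by
    intro k
    induction k with
    | zero => intro x; simp
    | succ k ih =>
      intro x
      rw [sum_stageCost_succ hγ hLxx hπ]
      refine (add_le_add le_rfl
        (mul_le_mul_right (lintegral_mono fun ξ => ih (S.dyn x (S.policy P x) ξ)) _)).trans ?_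
      rw [ofReal_cost_add_lintegral hγ hLxx hcost hnoise hP ha0, policy_eq hP.isSymm,
        qForm_augPolicy hγ hLuu hP, hric, hfix]
  rw [policyCost_eq_tsum hLxx hπ, ENNReal.tsum_eq_iSup_nat]
  exact iSup_le fun k => hb k x

theorem isOptimalPolicy_policy (hγ : 0 ≤ S.γ) (hγ₁ : S.γ < 1) (hLxx : S.Lxx.IsSymm)
    (hLuu : S.Luu.PosDef) (hcost : ∀ x u, 0 ≤ S.cost x u)
    (hnoise : ∀ i, MemLp (fun ξ : Fin n → ℝ => ξ i) 2 S.noise) (hsol : S.IsRiccatiSolution Q)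
    (hQ : Tendsto (S.riccatiIter 0) atTop (𝓝 Q)) : S.IsOptimalPolicy (S.policy Q) := by
  have hπ : Measurable (S.policy Q) := by
    have : Continuous (S.policy Q) := by unfold policy; fun_prop
    exact this.measurable
  obtain ⟨hP, hric⟩ := isRiccatiSolution_iff.1 hsol
  exact ⟨hπ, fun π' hπ' x =>
    (policyCost_policy_le hγ hγ₁ hLxx hLuu hcost hnoise hP hric hπ x).trans
      (le_policyCost hγ hγ₁ hLxx hLuu hcost hnoise hπ' hQ x)⟩

end Noise

end AffineLQ

end

/-! ### Assembly of the proposition -/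

open AffineLQ

theorem proposition3 {n m : ℕ} (S : AffineLQ n m) [IsProbabilityMeasure S.noise]
    (hγ₀ : 0 < S.γ) (hγ₁ : S.γ < 1)
    (hstab : S.Stabilizable)
    (hLxx : S.Lxx.IsSymm) (hLuu : S.Luu.PosDef)
    (hcost : ∀ x u, 0 ≤ S.cost x u)
    (hnoise : ∀ i, MemLp (fun ξ : Fin n → ℝ => ξ i) 2 S.noise) :
    -- every positive semidefinite Riccati solution yields fixed points and the same minimizer
    (∀ P, S.IsRiccatiSolution P →
      (S.qc P).PosDef ∧
      QuadGrowth (S.qStar P) ∧ QuadGrowth (S.qHat P) ∧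
      S.IsBellmanFixedPoint (S.qStar P) ∧
      S.IsRelaxedFixedPoint (S.qHat P) ∧
      0 ≤ S.gap P ∧
      (∀ x u, 0 ≤ S.qStar P x u ∧ S.qStar P x u ≤ S.qHat P x u) ∧
      (∀ x, {u | ∀ w, S.qHat P x u ≤ S.qHat P x w} = {S.policy P x}) ∧
      (∀ x, {u | ∀ w, S.qStar P x u ≤ S.qStar P x w} = {S.policy P x})) ∧
    -- the least Riccati solution exists and yields the optimal fixed points and policy
    ∃ P, S.IsRiccatiSolution P ∧
      (∀ P', S.IsRiccatiSolution P' → (P' - P).PosSemidef) ∧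
      S.IsOptimalPolicy (S.policy P) ∧
      (∀ q : (Fin n → ℝ) → (Fin m → ℝ) → ℝ, Measurable (Function.uncurry q) →
        (∀ x u, 0 ≤ q x u) → S.IsBellmanFixedPoint q → ∀ x u, S.qStar P x u ≤ q x u) ∧
      (∀ q : (Fin n → ℝ) → (Fin m → ℝ) → ℝ, Measurable (Function.uncurry q) →
        (∀ x u, 0 ≤ q x u) → S.IsRelaxedFixedPoint q → ∀ x u, S.qHat P x u ≤ q x u) ∧
      -- the fixed points are unique exactly when the Riccati solution is
      ((∀ q : (Fin n → ℝ) → (Fin m → ℝ) → ℝ, QuadGrowth q →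
        (∀ x u, 0 ≤ q x u) → S.IsBellmanFixedPoint q → q = S.qStar P) ↔
          ∀ P', S.IsRiccatiSolution P' → P' = P) ∧
      ((∀ q : (Fin n → ℝ) → (Fin m → ℝ) → ℝ, QuadGrowth q →
        (∀ x u, 0 ≤ q x u) → S.IsRelaxedFixedPoint q → q = S.qHat P) ↔
          ∀ P', S.IsRiccatiSolution P' → P' = P) := by
  have hγ := hγ₀.le
  have h1γ : 0 < 1 - S.γ := by linarith
  obtain ⟨Q, hQ, hsol, hleast⟩ := exists_least_riccati hγ₀ hγ₁ hstab hLxx hLuu hcost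
  obtain ⟨hQps, hQric⟩ := isRiccatiSolution_iff.1 hsol
  have hstar : ∀ P, S.IsRiccatiSolution P → S.qStar P = fun x u =>
      S.qForm P (aug x) u + S.γ * (P.toBlocks₁₁ * S.cov).trace / (1 - S.γ) := fun P hP => by
    funext x u; exact qStar_eq hLxx hP.1.isSymm x u
  have hhat : ∀ P, S.IsRiccatiSolution P → S.qHat P = fun x u =>
      S.qForm P (aug x) u + S.γ * ((S.augQ P).toBlocks₁₁ * S.cov).trace / (1 - S.γ) :=
    fun P hP => by
      funext x u; exact qHat_eq hLxx hP.1.isSymm (isRiccatiSolution_iff.1 hP).2 x u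
  have riccatiProps : ∀ P, S.IsRiccatiSolution P →
      (S.qc P).PosDef ∧ QuadGrowth (S.qStar P) ∧ QuadGrowth (S.qHat P) ∧
      S.IsBellmanFixedPoint (S.qStar P) ∧ S.IsRelaxedFixedPoint (S.qHat P) ∧ 0 ≤ S.gap P ∧
      (∀ x u, 0 ≤ S.qStar P x u ∧ S.qStar P x u ≤ S.qHat P x u) ∧
      (∀ x, {u | ∀ w, S.qHat P x u ≤ S.qHat P x w} = {S.policy P x}) ∧
      (∀ x, {u | ∀ w, S.qStar P x u ≤ S.qStar P x w} = {S.policy P x}) := by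
    intro P hP
    obtain ⟨hps, hric⟩ := isRiccatiSolution_iff.1 hP
    have hgap := gap_nonneg hγ hγ₁ hLuu hnoise hps
    refine ⟨qc_posDef hγ hLuu hps, ?_, ?_, ?_, ?_, hgap, fun x u => ⟨?_, ?_⟩, fun x => ?_,
      fun x => ?_⟩
    · rw [hstar P hP]; exact quadGrowth_qForm hps.isSymm _
    · rw [hhat P hP]; exact quadGrowth_qForm hps.isSymm _
    · rw [hstar P hP]; exact isBellmanFixedPoint_qForm hγ hγ₁ hLxx hLuu hnoise hps hric
    · rw [hhat P hP]; exact isRelaxedFixedPoint_qForm hγ hγ₁ hLxx hLuu hnoise hps hric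
    · rw [hstar P hP]
      exact add_nonneg (qForm_nonneg hγ hLxx hcost hps _ _)
        (div_nonneg (mul_nonneg hγ (trace_toBlocks_mul_cov_nonneg hnoise hps)) h1γ.le)
    · exact le_add_of_nonneg_right hgap
    · ext u
      simp only [hhat P hP, add_le_add_iff_right, Set.mem_ofPred_eq, Set.mem_singleton_iff,
        qForm_le_qForm_iff hγ hLuu hps, policy_eq hps.isSymm]
    · ext u
      simp only [hstar P hP, add_le_add_iff_right, Set.mem_ofPred_eq, Set.mem_singleton_iff,
        qForm_le_qForm_iff hγ hLuu hps, policy_eq hps.isSymm]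
  have leastF : ∀ q : (Fin n → ℝ) → (Fin m → ℝ) → ℝ, (∀ x u, 0 ≤ q x u) →
      S.IsBellmanFixedPoint q → ∀ x u, S.qStar Q x u ≤ q x u := by
    intro q hq0 hq x u
    rw [hstar Q hsol]
    refine bellman_lower_bound hγ hγ₁ hLxx hLuu hcost hnoise hq (a := 0) .zero (fun x u => ?_)
      hQ x u
    -- The iteration starts because a nonnegative fixed point is at least the stage cost.
    rw [qForm_zero hLxx, add_zero, ← hq.2.2 x u, bellman]
    exact le_add_of_nonneg_right
      (mul_nonneg hγ (integral_nonneg fun ξ => Real.iInf_nonneg fun w => hq0 _ _))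
  have leastR : ∀ q : (Fin n → ℝ) → (Fin m → ℝ) → ℝ, (∀ x u, 0 ≤ q x u) →
      S.IsRelaxedFixedPoint q → ∀ x u, S.qHat Q x u ≤ q x u := by
    intro q hq0 hq x u
    rw [hhat Q hsol]
    refine relaxed_lower_bound hγ hγ₁ hLxx hLuu hcost hnoise hq (a := 0) .zero (fun x u => ?_)
      hQ x u
    rw [qForm_zero hLxx, add_zero, ← hq.2.2 x u, relaxedBellman]
    exact le_add_of_nonneg_right
      (mul_nonneg hγ (Real.iInf_nonneg fun w => integral_nonneg fun ξ => hq0 _ _))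
  refine ⟨riccatiProps, Q, hsol, hleast, isOptimalPolicy_policy hγ hγ₁ hLxx hLuu hcost hnoise hsol hQ,
    fun q _ => leastF q, fun q _ => leastR q, ⟨fun h P' hP' => ?_, fun h q hqS hq0 hq => ?_⟩,
    ⟨fun h P' hP' => ?_, fun h q hqS hq0 hq => ?_⟩⟩
  · obtain ⟨hps', hric'⟩ := isRiccatiSolution_iff.1 hP'
    obtain ⟨-, hg, -, hfix, -, -, hnn, -⟩ := riccatiProps P' hP'
    have heq := h _ hg (fun x u => (hnn x u).1) hfix
    rw [hstar P' hP', hstar Q hsol] at heq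
    obtain ⟨hb, hall⟩ := eq_of_quadVal_aug_eq hps'.isSymm hQps.isSymm
      (quadVal_aug_eq_of_qForm_eq hγ hLuu hps' hric' hQps hQric
        fun x u => congrFun (congrFun heq x) u)
    -- Equal upper left blocks give equal constants, so the corner entries agree as well.
    exact hall (by rw [hb])
  · obtain ⟨-, C, hC⟩ := hqS
    have hC0 : 0 ≤ C := by
      have h0 := (abs_nonneg _).trans (hC 0 0)
      simpa using h0
    obtain ⟨U, hU, hCU, hUr⟩ := exists_riccati_le hγ₀ hγ₁ hstab hLuu hC0
    obtain ⟨Q', hQ', hsol'⟩ := exists_tendsto_riccatiIter hγ hLxx hLuu hcost hU hUr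
    -- By uniqueness the iteration descending from the supersolution `U` also ends at the least
    -- solution `Q`.
    rw [h Q' hsol'] at hQ'
    funext x u
    refine le_antisymm ?_ (leastF q hq0 hq x u)
    rw [hstar Q hsol]
    exact bellman_upper_bound hγ hγ₁ hLxx hLuu hcost hnoise hq hU
      (bellman_initial_upper hγ hLxx hnoise hq hC hU hCU) hQ' x u
  · obtain ⟨hps', hric'⟩ := isRiccatiSolution_iff.1 hP'
    obtain ⟨-, -, hg, -, hfix, -, hnn, -⟩ := riccatiProps P' hP'
    have heq := h _ hg (fun x u => (hnn x u).1.trans (hnn x u).2) hfix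
    rw [hhat P' hP', hhat Q hsol] at heq
    obtain ⟨hb, hall⟩ := eq_of_quadVal_aug_eq hps'.isSymm hQps.isSymm
      (quadVal_aug_eq_of_qForm_eq hγ hLuu hps' hric' hQps hQric
        fun x u => congrFun (congrFun heq x) u)
    refine hall ?_
    -- The constant of `F̂` involves the block of `augQ`, which the Riccati equation expresses
    -- through the common block of the two solutions.
    rw [augQ_toBlocks₁₁ hric', augQ_toBlocks₁₁ hQric, hb, ql_congr hb, qc_congr hb]
  · obtain ⟨-, C, hC⟩ := hqS
    have hC0 : 0 ≤ C := by
      have h0 := (abs_nonneg _).trans (hC 0 0)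
      simpa using h0
    obtain ⟨U, hU, hCU, hUr⟩ := exists_riccati_le hγ₀ hγ₁ hstab hLuu hC0
    obtain ⟨Q', hQ', hsol'⟩ := exists_tendsto_riccatiIter hγ hLxx hLuu hcost hU hUr
    rw [h Q' hsol'] at hQ'
    funext x u
    refine le_antisymm ?_ (leastR q hq0 hq x u)
    rw [hhat Q hsol]
    exact relaxed_upper_bound hγ hγ₁ hLxx hLuu hcost hnoise hq hU
      (relaxed_initial_upper hγ hLxx hnoise hq hC hU hCU) hQ' x u
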